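/- Let $d\ge 2$ and let $S^d\subset\mathbb{R}^{d+1}$ be the unit sphere with its surface measure normalized to total mass one. For $\ell\in\mathbb{N}_0$ let $$n_{\ell d}=\frac{2\ell+d-1}{\ell}\binom{\ell+d-2}{\ell-1}\quad(\ell\ge 1),\qquad n_{0d}=1,$$ which is the dimension of the space of real eigenfunctions of the Laplace–Beltrami operator $\Delta_{S^d}$ for the eigenvalue $-\ell(\ell+d-1)$, and let $Y_{\ell 1},\dots,Y_{\ell n_{\ell d}}$ be any orthonormal basis of this eigenspace in $L^2(S^d)$. For $\alpha_\ell=(\alpha_{\ell 1},\dots,\alpha_{\ell n_{\ell d}})$ in the unit sphere of $\mathbb{R}^{n_{\ell d}}$ put $$h_{\alpha,\ell}(x)=\sum_{m=1}^{n_{\ell d}}\alpha_{\ell m}Y_{\ell m}(x),\qquad x\in S^d,$$ and let $$d_{Kol}(h_{\alpha,\ell}(X),Z)=\sup_{u\in\mathbb{R}}\bigl|\Pr(h_{\alpha,\ell}(X)\le u)-\Phi(u)\bigr|$$ be the Kolmogorov distance of $h_{\alpha,\ell}(X)$ and $Z$, where $X$ is uniformly distributed on $S^d$ and $Z$ is standard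 Gaussian with distribution function $\Phi$. Let $\mu_\ell$ be the normalized surface measure on the unit sphere of $\mathbb{R}^{n_{\ell d}}$ and let $\mu=\bigotimes_{\ell\ge 0}\mu_\ell$ be the product probability measure. Then for every sequence $(\varepsilon_\ell)_{\ell\ge 0}$ of positive real numbers with $$\sum_{\ell=0}^{\infty}\frac{1}{n_{\ell d}\,\varepsilon_\ell^{3}}<\infty$$ it holds that $$\mu\bigl(\{(\alpha_\ell)_{\ell\ge 0}\colon d_{Kol}(h_{\alpha,\ell}(X),Z)>\varepsilon_\ell\ \text{for infinitely many } \ell\}\bigr)=0 .$$ -/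

import Mathlib

open MeasureTheory ProbabilityTheory Filter
open scoped ContDiff

noncomputable section

namespace SphHarm

/-- The unit sphere of `ℝᵏ`, with `ℝᵏ` carrying the Euclidean norm; the sphere `S^d` is
`USphere (d + 1)`. -/
abbrev USphere (k : ℕ) : Type := Metric.sphere (0 : EuclideanSpace ℝ (Fin k)) 1

/-- The surface measure of the unit sphere of `ℝᵏ`, normalized to have total mass one. -/
def unif (k : ℕ) : Measure (USphere k) :=
  ((volume : Measure (EuclideanSpace ℝ (Fin k))).toSphere Set.univ)⁻¹ •
    (volume : Measure (EuclideanSpace ℝ (Fin k))).toSphere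

theorem isProbabilityMeasure_unif {k : ℕ} (hk : 0 < k) : IsProbabilityMeasure (unif k) := by
  have : NeZero k := ⟨hk.ne'⟩
  have : Nontrivial (EuclideanSpace ℝ (Fin k)) := by
    apply Module.nontrivial_of_finrank_pos (R := ℝ)
    simpa using hk
  refine ⟨?_⟩
  rw [unif, Measure.smul_apply, smul_eq_mul]
  apply ENNReal.inv_mul_cancel
  · rw [Ne, Measure.measure_univ_eq_zero]
    exact Measure.toSphere_ne_zero _
  · exact measure_ne_top _ _

/-- The radial extension `x ↦ f (x / |x|)` of a function on `S^d` to `ℝ^(d+1)` without the origin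
(with the irrelevant value `0` at the origin). -/
def radialExt {d : ℕ} (f : USphere (d + 1) → ℝ) (x : EuclideanSpace ℝ (Fin (d + 1))) : ℝ :=
  open Classical in
  if hx : x = 0 then 0
  else f ⟨‖x‖⁻¹ • x, by simp [norm_smul, inv_mul_cancel₀ (norm_ne_zero_iff.mpr hx)]⟩

/-- Smoothness of a function on `S^d`: its radial extension is smooth away from the origin. -/
def SmoothOnSphere {d : ℕ} (f : USphere (d + 1) → ℝ) : Prop :=
  ContDiffOn ℝ ∞ (radialExt f) {0}ᶜ

/-- The Laplace-Beltrami operator of the round unit sphere `S^d`: the restriction to the sphere of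
the Euclidean Laplacian of the radial extension. -/
def laplaceBeltrami {d : ℕ} (f : USphere (d + 1) → ℝ) (x : USphere (d + 1)) : ℝ :=
  Laplacian.laplacian (radialExt f) (x : EuclideanSpace ℝ (Fin (d + 1)))

/-- Real hyperspherical harmonics of degree `ℓ` on `S^d`: the smooth eigenfunctions of the
Laplace-Beltrami operator for the eigenvalue `-ℓ (ℓ + d - 1)`. -/
def IsHarmonic (d ℓ : ℕ) (f : USphere (d + 1) → ℝ) : Prop :=
  SmoothOnSphere f ∧
    ∀ x, laplaceBeltrami f x = -((ℓ : ℝ) * ((ℓ : ℝ) + (d : ℝ) - 1)) * f x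

/-- The dimension `n_{ℓ d}` of the space of hyperspherical harmonics of degree `ℓ` on `S^d`,
`d ≥ 2`: it is `1` for `ℓ = 0` and `(2ℓ + d - 1) / ℓ * binom (ℓ + d - 2) (ℓ - 1)` for `ℓ ≥ 1`.
The division is exact. -/
def harmDim (ℓ d : ℕ) : ℕ :=
  if ℓ = 0 then 1 else (2 * ℓ + d - 1) * (ℓ + d - 2).choose (ℓ - 1) / ℓ

theorem dvd_harmDim_aux {ℓ d : ℕ} (hℓ : 1 ≤ ℓ) (hd : 2 ≤ d) :
    ℓ ∣ (2 * ℓ + d - 1) * (ℓ + d - 2).choose (ℓ - 1) := by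
  obtain ⟨k, rfl⟩ : ∃ k, ℓ = k + 1 := ⟨ℓ - 1, by omega⟩
  have h := Nat.choose_succ_right_eq (k + 1 + d - 2) k
  have e1 : k + 1 + d - 2 - k = d - 1 := by omega
  have e2 : 2 * (k + 1) + d - 1 = 2 * (k + 1) + (d - 1) := by omega
  rw [e1] at h
  rw [e2, Nat.add_sub_cancel, add_mul]
  refine dvd_add ⟨2 * (k + 1 + d - 2).choose k, by ring⟩ ?_
  exact ⟨(k + 1 + d - 2).choose (k + 1), by rw [mul_comm, ← h, mul_comm]⟩

theorem harmDim_cast {ℓ d : ℕ} (hℓ : 1 ≤ ℓ) (hd : 2 ≤ d) :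
    (harmDim ℓ d : ℝ) =
      (2 * (ℓ : ℝ) + (d : ℝ) - 1) / (ℓ : ℝ) * ((ℓ + d - 2).choose (ℓ - 1) : ℝ) := by
  have h0 : ℓ ≠ 0 := by omega
  rw [harmDim, if_neg h0, Nat.cast_div (dvd_harmDim_aux hℓ hd) (by exact_mod_cast h0),
    Nat.cast_mul, Nat.cast_sub (by omega)]
  push_cast
  ring

theorem harmDim_pos (ℓ : ℕ) {d : ℕ} (hd : 2 ≤ d) : 0 < harmDim ℓ d := by
  rcases Nat.eq_zero_or_pos ℓ with rfl | hℓ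
  · simp [harmDim]
  · rw [harmDim, if_neg hℓ.ne']
    refine Nat.div_pos (Nat.le_of_dvd ?_ (dvd_harmDim_aux hℓ hd)) hℓ
    exact Nat.mul_pos (by omega) (Nat.choose_pos (by omega))

/-- `(Y_m)`, `1 ≤ m ≤ n_{ℓ d}`, is an orthonormal basis, in `L²` of the normalized measure on `S^d`,
of the eigenspace of hyperspherical harmonics of degree `ℓ`. -/
structure IsHarmonicONB (d ℓ : ℕ) (Y : Fin (harmDim ℓ d) → USphere (d + 1) → ℝ) : Prop where
  harmonic : ∀ m, IsHarmonic d ℓ (Y m)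
  orthonormal : ∀ m m', ∫ x, Y m x * Y m' x ∂(unif (d + 1)) = if m = m' then 1 else 0
  spans : ∀ f, IsHarmonic d ℓ f → f ∈ Submodule.span ℝ (Set.range Y)

/-- The eigenfunction `h_{α, ℓ} = ∑ₘ α_{ℓ m} Y_{ℓ m}` with coefficients on the unit sphere. -/
def eigenfun {d n : ℕ} (Y : Fin n → USphere (d + 1) → ℝ) (α : USphere n)
    (x : USphere (d + 1)) : ℝ :=
  ∑ m, (α : EuclideanSpace ℝ (Fin n)) m * Y m x

/-- The Kolmogorov distance of two probability measures on `ℝ`. -/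
def kolDist (P Q : Measure ℝ) : ℝ :=
  ⨆ u : ℝ, |P.real (Set.Iic u) - Q.real (Set.Iic u)|

/-- The Kolmogorov distance of `h (X)` and `Z`, where `X` is uniformly distributed on `S^d` and `Z` is
standard Gaussian. -/
def dKolGauss {d : ℕ} (h : USphere (d + 1) → ℝ) : ℝ :=
  kolDist ((unif (d + 1)).map h) (gaussianReal 0 1)

/-- The product over `ℓ` of the normalized measures on the coefficient spheres. -/
def coeffMeasure (d : ℕ) : Measure (∀ ℓ : ℕ, USphere (harmDim ℓ d)) :=
  Measure.infinitePi fun ℓ => unif (harmDim ℓ d)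

theorem isProbabilityMeasure_coeffMeasure {d : ℕ} (hd : 2 ≤ d) :
    IsProbabilityMeasure (coeffMeasure d) := by
  have : ∀ ℓ, IsProbabilityMeasure (unif (harmDim ℓ d)) := fun ℓ =>
    isProbabilityMeasure_unif (harmDim_pos ℓ hd)
  unfold coeffMeasure
  infer_instance

end SphHarm

end

noncomputable section

namespace SphHarm

/-! Write n for `harmDim ℓ d`, ρ for the inner product of y(x) and y(x'), and h_{α,ℓ}(x) = √n ⟨y(x),
α⟩ with y(x) = (Y_m(x))_m / √n. By rotation invariance `IsHarmonicONB.sum_sq` gives |y(x)| = 1.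
Replace the uniform α by g/|g| with g standard Gaussian (`stdGaussian_direction`). For each x the
variable ⟨y(x), g⟩ is N(0,1), so the random distribution function F_g(t) of x ↦ ⟨y(x), g⟩ has mean
Φ(t).

Its second moment averages, over pairs x, x', the probability that two standard Gaussians with
correlation ρ are both at most t. This is at most Φ(t)² + c(t)ρ + Kρ² with 0 ≤ c(t) ≤ K
(`exists_stdGaussian_inner_inner_le`). Orthonormality makes the averages of ρ and ρ² at most 1/n, so
Var F_g(t) = O(1/n). Chebyshev's inequality at about 1/ε Gaussian quantiles, and for |g|²/n, bounds
the probability of a Kolmogorov distance above ε by O(1/(nε³)) (`exists_kolDist_concentration`). The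
Borel-Cantelli lemma concludes. -/

/-! ### Bivariate Gaussian probabilities for small correlation -/

theorem exp_le_quadratic (v : ℝ) : Real.exp v ≤ 1 + v + v ^ 2 * Real.exp |v| := by
  have h := Complex.norm_exp_sub_sum_le_norm_mul_exp (v : ℂ) 2
  simp only [Finset.sum_range_succ, Finset.sum_range_zero, zero_add, pow_zero, pow_one,
    Nat.factorial, Nat.cast_one, div_one, Complex.norm_real, Real.norm_eq_abs, mul_one,
    sq_abs] at h
  rw [← Complex.ofReal_exp, ← Complex.ofReal_one, ← Complex.ofReal_add, ← Complex.ofReal_sub,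
    Complex.norm_real, Real.norm_eq_abs] at h
  linarith [le_abs_self (Real.exp v - (1 + v))]

/-- The left side is the density of a Gaussian pair with correlation ρ relative to the independent
pair. The linear term is kept exactly, since only ρ² may be estimated crudely. The weight in the
error splits into a product and is integrable against the Gaussian, as 1/4 < 1/2. -/
theorem bivariate_density_ratio_le {ρ : ℝ} (hρ : |ρ| ≤ 1 / 4) (a b : ℝ) :
    (√(1 - ρ ^ 2))⁻¹ *
        Real.exp ((2 * ρ * a * b - ρ ^ 2 * (a ^ 2 + b ^ 2)) / (2 * (1 - ρ ^ 2))) ≤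
      1 + ρ * a * b + 200 * ρ ^ 2 * Real.exp ((a ^ 2 + b ^ 2) / 4) := by
  have hρ2 : ρ ^ 2 ≤ 1 / 16 := by
    have := abs_le.mp hρ; nlinarith
  set q := a ^ 2 + b ^ 2 with hq
  have hq0 : 0 ≤ q := by positivity
  have hs : 0 < 1 - ρ ^ 2 := by linarith
  have hsqrt : (√(1 - ρ ^ 2))⁻¹ ≤ 1 + ρ ^ 2 := by
    apply inv_le_of_inv_le₀ (by positivity)
    apply Real.le_sqrt_of_sq_le
    rw [inv_pow, inv_le_comm₀ (by positivity) hs, inv_le_iff_one_le_mul₀ hs]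
    nlinarith [sq_nonneg ρ, mul_nonneg (sq_nonneg ρ) (sq_nonneg ρ),
      mul_nonneg (sq_nonneg ρ) (sub_nonneg.2 hρ2),
      mul_nonneg (mul_nonneg (sq_nonneg ρ) (sq_nonneg ρ)) (sub_nonneg.2 hρ2)]
  set v := ρ * a * b / (1 - ρ ^ 2) with hv
  have hw : (2 * ρ * a * b - ρ ^ 2 * q) / (2 * (1 - ρ ^ 2)) ≤ v := by
    rw [hv, div_le_div_iff₀ (by positivity) hs]
    nlinarith [mul_nonneg (mul_nonneg (sq_nonneg ρ) hq0) hs.le]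
  have hab : |a * b| ≤ q / 2 := by
    rw [abs_le]; constructor <;> nlinarith [sq_nonneg (a + b), sq_nonneg (a - b)]
  -- 8/15 is 1/2 from |ab| ≤ q/2 times 16/15 ≥ 1/(1 - ρ²).
  have habs : |v| ≤ |ρ| * q * (8 / 15) := by
    rw [hv, mul_assoc, abs_div, abs_mul, abs_of_pos hs, div_le_iff₀ hs]
    have h1 := mul_le_mul_of_nonneg_left hab (abs_nonneg ρ)
    have h2 : 0 ≤ |ρ| * q := by positivity
    nlinarith
  have hvq : |v| ≤ 2 * q / 15 := by nlinarith
  have hv2 : v ^ 2 ≤ ρ ^ 2 * q ^ 2 := by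
    rw [← sq_abs v, ← sq_abs ρ, ← mul_pow]
    apply pow_le_pow_left₀ (abs_nonneg _)
    have h2 : 0 ≤ |ρ| * q := by positivity
    linarith
  have hv1 : v ≤ ρ * a * b + ρ ^ 2 * q := by
    have e : v = ρ * a * b + ρ ^ 2 * v := by rw [hv]; field_simp; ring
    have h3 : ρ ^ 2 * v ≤ ρ ^ 2 * q :=
      mul_le_mul_of_nonneg_left (by linarith [le_abs_self v]) (sq_nonneg ρ)
    linarith
  set E := Real.exp (2 * q / 15) with hE
  have hE1 : Real.exp |v| ≤ E := Real.exp_le_exp.2 hvq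
  have hE2 : Real.exp v ≤ E := (Real.exp_le_exp.2 (le_abs_self v)).trans hE1
  have hEge : 1 ≤ E := Real.one_le_exp (by positivity)
  have h1 : Real.exp v ≤ 1 + ρ * a * b + ρ ^ 2 * q + ρ ^ 2 * q ^ 2 * E := by
    have h4 : v ^ 2 * Real.exp |v| ≤ ρ ^ 2 * q ^ 2 * E := by gcongr
    linarith [exp_le_quadratic v]
  -- The slack 1/4 - 2/15 = 7/60 in the exponent absorbs the polynomial factors.
  have h5 : q + (q ^ 2 + 1) * E ≤ 200 * Real.exp (q / 4) := by
    have e : Real.exp (q / 4) = E * Real.exp (7 * q / 60) := by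
      rw [hE, ← Real.exp_add]; congr 1; ring
    have h6 := Real.quadratic_le_exp_of_nonneg (x := 7 * q / 60) (by positivity)
    have h7 : q + q ^ 2 + 1 ≤ 200 * Real.exp (7 * q / 60) := by nlinarith
    rw [e]
    have h8 := mul_le_mul_of_nonneg_left h7 (by positivity : 0 ≤ E)
    nlinarith
  calc _ ≤ (1 + ρ ^ 2) * Real.exp v := by gcongr
    _ ≤ Real.exp v + ρ ^ 2 * E := by nlinarith [sq_nonneg ρ]
    _ ≤ 1 + ρ * a * b + ρ ^ 2 * (q + (q ^ 2 + 1) * E) := by linarith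
    _ ≤ _ := by nlinarith [mul_le_mul_of_nonneg_left h5 (sq_nonneg ρ)]

/-- The left side is the conditional density of the second variable of the correlated pair when the
first equals a. -/
theorem gaussianPDFReal_correlated {ρ : ℝ} (hρ : ρ ^ 2 < 1) (a b : ℝ) :
    gaussianPDFReal (ρ * a) (1 - ρ ^ 2).toNNReal b =
      gaussianPDFReal 0 1 b * ((√(1 - ρ ^ 2))⁻¹ *
        Real.exp ((2 * ρ * a * b - ρ ^ 2 * (a ^ 2 + b ^ 2)) / (2 * (1 - ρ ^ 2)))) := by
  have hs : 0 < 1 - ρ ^ 2 := by linarith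
  simp only [gaussianPDFReal, Real.coe_toNNReal _ hs.le, NNReal.coe_one, mul_one, sub_zero]
  rw [Real.sqrt_mul (by positivity), mul_inv]
  rw [show ∀ x y z w : ℝ, x * y * (z * w) = x * z * (y * w) by intros; ring, ← Real.exp_add]
  congr 2
  field_simp
  ring

theorem integrable_gaussianReal_iff {f : ℝ → ℝ} :
    Integrable f (gaussianReal 0 1) ↔ Integrable fun x => gaussianPDFReal 0 1 x * f x := by
  rw [gaussianReal_of_var_ne_zero _ one_ne_zero,
    integrable_withDensity_iff_integrable_smul' (measurable_gaussianPDF _ _)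
      (ae_of_all _ fun _ => gaussianPDF_lt_top)]
  simp [toReal_gaussianPDF]

theorem setIntegral_gaussianReal {f : ℝ → ℝ} {A : Set ℝ} (hA : MeasurableSet A) :
    ∫ x in A, f x ∂(gaussianReal 0 1) = ∫ x in A, gaussianPDFReal 0 1 x * f x := by
  rw [← integral_indicator hA, integral_gaussianReal_eq_integral_smul one_ne_zero,
    ← integral_indicator hA]
  congr 1 with x
  by_cases hx : x ∈ A <;> simp [hx]

theorem integrable_exp_sq_quarter :
    Integrable (fun z : ℝ => Real.exp (z ^ 2 / 4)) (gaussianReal 0 1) := by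
  rw [integrable_gaussianReal_iff]
  convert (integrable_exp_neg_mul_sq (b := 1 / 4) (by norm_num)).const_mul (√(2 * Real.pi))⁻¹
    using 2 with z
  simp only [gaussianPDFReal, NNReal.coe_one, mul_one, sub_zero, mul_assoc, ← Real.exp_add]
  congr 2
  ring

theorem integrable_id_gaussianReal : Integrable (fun z : ℝ => z) (gaussianReal 0 1) :=
  (memLp_id_gaussianReal 1).integrable le_rfl

theorem map_affine_gaussianReal {ρ : ℝ} (hρ : ρ ^ 2 < 1) (a : ℝ) :
    (gaussianReal 0 1).map (fun w => ρ * a + √(1 - ρ ^ 2) * w) =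
      gaussianReal (ρ * a) (1 - ρ ^ 2).toNNReal := by
  have : (fun w => ρ * a + √(1 - ρ ^ 2) * w) = (ρ * a + ·) ∘ (√(1 - ρ ^ 2) * ·) := rfl
  rw [this, ← Measure.map_map (by fun_prop) (by fun_prop), gaussianReal_map_const_mul,
    gaussianReal_map_const_add]
  congr 1
  · simp
  · ext; simp [Real.sq_sqrt, (by linarith : 0 ≤ 1 - ρ ^ 2)]

/-- The probability that two standard Gaussians with a small correlation `ρ` both lie in a set
is, up to an error of order `ρ²`, an affine function of `ρ`. -/
theorem correlated_gaussian_le {ρ : ℝ} (hρ : |ρ| ≤ 1 / 4) {A : Set ℝ} (hA : MeasurableSet A) :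
    ((gaussianReal 0 1).prod (gaussianReal 0 1)).real
        {p | p.1 ∈ A ∧ ρ * p.1 + √(1 - ρ ^ 2) * p.2 ∈ A} ≤
      (gaussianReal 0 1).real A ^ 2 + ρ * (∫ z in A, z ∂(gaussianReal 0 1)) ^ 2 +
        200 * (∫ z, Real.exp (z ^ 2 / 4) ∂(gaussianReal 0 1)) ^ 2 * ρ ^ 2 := by
  have hρ2 : ρ ^ 2 < 1 := by
    have := abs_le.mp hρ; nlinarith
  set γ := gaussianReal 0 1 with hγ
  set m := ∫ z in A, z ∂γ with hm
  set M := ∫ z, Real.exp (z ^ 2 / 4) ∂γ with hM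
  have hM0 : 0 ≤ M := integral_nonneg fun _ => (Real.exp_pos _).le
  have hMA : ∫ z in A, Real.exp (z ^ 2 / 4) ∂γ ≤ M :=
    setIntegral_le_integral integrable_exp_sq_quarter (ae_of_all _ fun _ => (Real.exp_pos _).le)
  set r : ℝ → ℝ → ℝ := fun a b => (√(1 - ρ ^ 2))⁻¹ *
        Real.exp ((2 * ρ * a * b - ρ ^ 2 * (a ^ 2 + b ^ 2)) / (2 * (1 - ρ ^ 2))) with hr
  have hv : (1 - ρ ^ 2).toNNReal ≠ 0 := by
    rw [Ne, Real.toNNReal_eq_zero]; linarith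
  -- Conditional probability given that the first variable is a; integrating over a in A then gives
  -- the claim.
  have hinner : ∀ a, γ.real ((fun w => ρ * a + √(1 - ρ ^ 2) * w) ⁻¹' A) ≤
      γ.real A + ρ * a * m + 200 * ρ ^ 2 * M * Real.exp (a ^ 2 / 4) := by
    intro a
    have hi : Integrable (r a) γ := by
      rw [hγ, integrable_gaussianReal_iff]
      simp_rw [hr, ← gaussianPDFReal_correlated hρ2]
      exact integrable_gaussianPDFReal _ _
    have e1 : γ.real ((fun w => ρ * a + √(1 - ρ ^ 2) * w) ⁻¹' A) = ∫ b in A, r a b ∂γ := by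
      rw [← map_measureReal_apply (by fun_prop) hA, map_affine_gaussianReal hρ2 a, measureReal_def,
        gaussianReal_apply_eq_integral _ hv, ENNReal.toReal_ofReal]
      · simp_rw [gaussianPDFReal_correlated hρ2]
        rw [hγ, setIntegral_gaussianReal hA]
      · exact integral_nonneg fun _ => gaussianPDFReal_nonneg _ _ _
    rw [e1]
    calc ∫ b in A, r a b ∂γ ≤ ∫ b in A, (1 + ρ * a * b + 200 * ρ ^ 2 * Real.exp (a ^ 2 / 4) * Real.exp (b ^ 2 / 4)) ∂γ := by
          apply integral_mono hi.integrableOn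
          · exact (((integrable_const _).add (integrable_id_gaussianReal.const_mul _)).add
              (integrable_exp_sq_quarter.const_mul _)).integrableOn
          · intro b
            refine (bivariate_density_ratio_le hρ a b).trans_eq ?_
            rw [add_div, Real.exp_add]; ring
      _ = γ.real A + ρ * a * m + 200 * ρ ^ 2 * Real.exp (a ^ 2 / 4) * ∫ z in A, Real.exp (z ^ 2 / 4) ∂γ := by
          rw [integral_add, integral_add, integral_const_mul, integral_const_mul]
          · simp [hm]
          · exact integrable_const _
          · exact (integrable_id_gaussianReal.const_mul _).integrableOn
          · exact ((integrable_const _).add (integrable_id_gaussianReal.const_mul _)).integrableOn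
          · exact (integrable_exp_sq_quarter.const_mul _).integrableOn
      _ ≤ _ := by
          have := mul_le_mul_of_nonneg_left hMA (by positivity : 0 ≤ 200 * ρ ^ 2 * Real.exp (a ^ 2 / 4))
          linarith
  have hmeas : MeasurableSet {p : ℝ × ℝ | p.1 ∈ A ∧ ρ * p.1 + √(1 - ρ ^ 2) * p.2 ∈ A} := by
    apply MeasurableSet.inter
    · exact measurable_fst hA
    · exact (by fun_prop : Measurable fun p : ℝ × ℝ => ρ * p.1 + √(1 - ρ ^ 2) * p.2) hA
  have hfub : (γ.prod γ).real {p | p.1 ∈ A ∧ ρ * p.1 + √(1 - ρ ^ 2) * p.2 ∈ A} =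
      ∫ a in A, γ.real ((fun w => ρ * a + √(1 - ρ ^ 2) * w) ⁻¹' A) ∂γ := by
    rw [← integral_indicator_one hmeas, integral_prod, ← integral_indicator hA]
    · congr 1 with a
      by_cases ha : a ∈ A
      · rw [Set.indicator_of_mem ha, ← integral_indicator_one
          ((by fun_prop : Measurable fun w => ρ * a + √(1 - ρ ^ 2) * w) hA)]
        congr 1 with w
        by_cases hw : ρ * a + √(1 - ρ ^ 2) * w ∈ A <;> simp [Set.indicator, ha, hw]
      · simp [Set.indicator, ha]
    · exact (integrable_indicator_iff hmeas).2 (integrable_const _).integrableOn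
  rw [hfub]
  calc _ ≤ ∫ a in A, (γ.real A + ρ * a * m + 200 * ρ ^ 2 * M * Real.exp (a ^ 2 / 4)) ∂γ := by
        apply integral_mono_of_nonneg
        · exact ae_of_all _ fun _ => measureReal_nonneg
        · exact (((integrable_const _).add ((integrable_id_gaussianReal.const_mul _).mul_const _)).add
              (integrable_exp_sq_quarter.const_mul _)).integrableOn
        · exact ae_of_all _ hinner
    _ = γ.real A ^ 2 + ρ * m ^ 2 + 200 * ρ ^ 2 * M * ∫ z in A, Real.exp (z ^ 2 / 4) ∂γ := by
          rw [integral_add, integral_add, integral_const_mul, integral_mul_const, integral_const_mul]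
          · simp [← hm]; ring
          · exact integrable_const _
          · exact ((integrable_id_gaussianReal.const_mul _).mul_const _).integrableOn
          · exact ((integrable_const _).add ((integrable_id_gaussianReal.const_mul _).mul_const _)).integrableOn
          · exact (integrable_exp_sq_quarter.const_mul _).integrableOn
    _ ≤ _ := by
          have := mul_le_mul_of_nonneg_left hMA (by positivity : 0 ≤ 200 * ρ ^ 2 * M)
          linarith

/-! ### Inner products with a standard Gaussian vector -/

section StdGaussian

variable {E : Type*} [NormedAddCommGroup E] [InnerProductSpace ℝ E] [FiniteDimensional ℝ E]
  [MeasurableSpace E] [BorelSpace E]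

theorem map_inner_stdGaussian {y : E} (hy : ‖y‖ = 1) :
    (stdGaussian E).map (fun g => inner ℝ y g) = gaussianReal 0 1 := by
  have h := IsGaussian.map_eq_gaussianReal (μ := stdGaussian E) (innerSL ℝ y)
  rw [integral_strongDual_stdGaussian, variance_dual_stdGaussian] at h
  simpa [hy] using h

theorem map_inner_inner_stdGaussian {y z : E} (hy : ‖y‖ = 1) (hz : ‖z‖ = 1)
    (hyz : inner ℝ y z = 0) :
    (stdGaussian E).map (fun g => (inner ℝ y g, inner ℝ z g)) =
      (gaussianReal 0 1).prod (gaussianReal 0 1) := by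
  have hlaw : HasGaussianLaw (fun g : E => (inner ℝ y g, inner ℝ z g)) (stdGaussian E) :=
    IsGaussian.hasGaussianLaw_id.map_fun ((innerSL ℝ y).prod (innerSL ℝ z))
  have hind : IndepFun (fun g : E => inner ℝ y g) (fun g : E => inner ℝ z g) (stdGaussian E) := by
    apply hlaw.indepFun_of_covariance_eq_zero
    rw [← covarianceBilin_apply_eq_cov IsGaussian.memLp_two_id, covarianceBilin_stdGaussian]
    exact hyz
  rw [(indepFun_iff_map_prod_eq_prod_map_map (by fun_prop) (by fun_prop)).1 hind,
    map_inner_stdGaussian hy, map_inner_stdGaussian hz]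

/-- Here c(t) is the square of the first Gaussian moment on (-∞, t]. Its sign matters: the average
of ρ will only be bounded from above. K and c do not depend on the space, hence not on the
dimension. -/
theorem exists_stdGaussian_inner_inner_le :
    ∃ (K : ℝ) (c : ℝ → ℝ), (∀ t, 0 ≤ c t) ∧ (∀ t, c t ≤ K) ∧ ∀ (E : Type) [NormedAddCommGroup E] [InnerProductSpace ℝ E]
      [FiniteDimensional ℝ E] [MeasurableSpace E] [BorelSpace E] (t : ℝ) (y y' : E),
      ‖y‖ = 1 → ‖y'‖ = 1 →
      (stdGaussian E).real {g | inner ℝ y g ≤ t ∧ inner ℝ y' g ≤ t} ≤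
        (gaussianReal 0 1).real (Set.Iic t) ^ 2 +
          c t * inner ℝ y y' + K * inner ℝ y y' ^ 2 := by
  set M := ∫ z, Real.exp (z ^ 2 / 4) ∂(gaussianReal 0 1)
  set m₁ := ∫ z, |z| ∂(gaussianReal 0 1) with hm₁
  have hm : ∀ t, (∫ z in Set.Iic t, z ∂(gaussianReal 0 1)) ^ 2 ≤ m₁ ^ 2 := by
    intro t
    rw [← sq_abs (∫ z in Set.Iic t, z ∂(gaussianReal 0 1))]
    apply pow_le_pow_left₀ (abs_nonneg _)
    exact abs_integral_le_integral_abs.trans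
      (setIntegral_le_integral integrable_id_gaussianReal.abs (ae_of_all _ fun _ => abs_nonneg _))
  refine ⟨200 * M ^ 2 + 4 * m₁ ^ 2 + 16, fun t => (∫ z in Set.Iic t, z ∂(gaussianReal 0 1)) ^ 2,
    fun t => sq_nonneg _, fun t => (hm t).trans (by nlinarith [sq_nonneg M, sq_nonneg m₁]), ?_⟩
  intro E _ _ _ _ _ t y y' hy hy'
  set ρ : ℝ := inner ℝ y y' with hρ
  replace hm := hm t
  set m := ∫ z in Set.Iic t, z ∂(gaussianReal 0 1)
  have hM : 0 ≤ M ^ 2 := sq_nonneg M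
  rcases le_or_gt |ρ| (1 / 4) with hs | hs
  · have hρ2 : ρ ^ 2 < 1 := by
      have := abs_le.mp hs; nlinarith
    have hs0 : 0 < 1 - ρ ^ 2 := by linarith
    set s := √(1 - ρ ^ 2) with hsdef
    have hspos : 0 < s := Real.sqrt_pos.2 hs0
    have hs2 : s ^ 2 = 1 - ρ ^ 2 := Real.sq_sqrt hs0.le
    -- Gram-Schmidt: y' = ρy + sz with z a unit vector orthogonal to y, so ⟨y, g⟩ and ⟨z, g⟩ are
    -- independent.
    set z : E := s⁻¹ • (y' - ρ • y) with hz
    have hyy : inner ℝ y y = (1 : ℝ) := by rw [real_inner_self_eq_norm_sq, hy, one_pow]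
    have hyy' : inner ℝ y' y' = (1 : ℝ) := by rw [real_inner_self_eq_norm_sq, hy', one_pow]
    have hyz : inner ℝ y z = (0 : ℝ) := by
      rw [hz, inner_smul_right, inner_sub_right, inner_smul_right, hyy, ← hρ]; ring
    have hz1 : ‖z‖ = 1 := by
      have : ‖z‖ ^ 2 = 1 := by
        rw [← real_inner_self_eq_norm_sq, hz, inner_smul_left, inner_smul_right, inner_sub_right,
          inner_sub_left, inner_sub_left, inner_smul_left, inner_smul_right, inner_smul_left,
          inner_smul_right, hyy, hyy', real_inner_comm y y', ← hρ]
        simp only [conj_trivial]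
        field_simp
        rw [hs2]; ring
      nlinarith [norm_nonneg z]
    have e : {g : E | inner ℝ y g ≤ t ∧ inner ℝ y' g ≤ t} =
        (fun g => (inner ℝ y g, inner ℝ z g)) ⁻¹'
          {p : ℝ × ℝ | p.1 ∈ Set.Iic t ∧ ρ * p.1 + √(1 - ρ ^ 2) * p.2 ∈ Set.Iic t} := by
      ext g
      have : inner ℝ y' g = ρ * inner ℝ y g + s * inner ℝ z g := by
        rw [hz, inner_smul_left, inner_sub_left, inner_smul_left]
        simp only [conj_trivial]
        field_simp
        ring
      simp [this, ← hsdef]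
    rw [e, ← map_measureReal_apply (by fun_prop), map_inner_inner_stdGaussian hy hz1 hyz]
    · refine (correlated_gaussian_le hs measurableSet_Iic).trans ?_
      have : 0 ≤ (4 * m₁ ^ 2 + 16) * ρ ^ 2 := by positivity
      linarith
    · apply MeasurableSet.inter
      · exact measurable_fst measurableSet_Iic
      · exact (by fun_prop : Measurable fun p : ℝ × ℝ => ρ * p.1 + √(1 - ρ ^ 2) * p.2)
          measurableSet_Iic
  -- For |ρ| > 1/4 the trivial bound 1 suffices: 16ρ² covers it, and 4m₁²ρ² compensates a negative
  -- linear term.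
  · have h1 : 1 ≤ 16 * ρ ^ 2 := by rw [← sq_abs]; nlinarith
    have h2 : |ρ| ≤ 4 * ρ ^ 2 := by rw [← sq_abs ρ]; nlinarith
    have h3 : -(ρ * m ^ 2) ≤ 4 * ρ ^ 2 * m₁ ^ 2 := by
      rw [← neg_mul]
      exact mul_le_mul ((neg_le_abs ρ).trans h2) hm (sq_nonneg _) (by positivity)
    have h4 : 0 ≤ 200 * M ^ 2 * ρ ^ 2 := by positivity
    have h5 : (0 : ℝ) ≤ (gaussianReal 0 1).real (Set.Iic t) ^ 2 := sq_nonneg _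
    refine measureReal_le_one.trans ?_
    linarith

end StdGaussian

/-! ### Norm and direction of a standard Gaussian vector -/

theorem pi_gaussianReal_eq_withDensity (ι : Type*) [Fintype ι] :
    Measure.pi (fun _ : ι => gaussianReal 0 1) =
      (volume : Measure (ι → ℝ)).withDensity fun x => ∏ i, gaussianPDF 0 1 (x i) := by
  refine Measure.pi_eq fun s hs => ?_
  rw [withDensity_apply _ (.univ_pi hs), volume_pi, Measure.restrict_pi_pi]
  have hi : ∀ i, Integrable (gaussianPDFReal 0 1) (volume.restrict (s i)) := fun i =>
    (integrable_gaussianPDFReal 0 1).integrableOn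
  simp_rw [gaussianPDF, gaussianReal_apply_eq_integral 0 one_ne_zero]
  simp_rw [← ENNReal.ofReal_prod_of_nonneg fun _ _ => gaussianPDFReal_nonneg _ _ _]
  rw [← ofReal_integral_eq_lintegral_ofReal (Integrable.fintype_prod hi)
    (ae_of_all _ fun _ => Finset.prod_nonneg fun _ _ => gaussianPDFReal_nonneg _ _ _),
    integral_fintype_prod_eq_prod, ENNReal.ofReal_prod_of_nonneg]
  exact fun _ _ => integral_nonneg fun _ => gaussianPDFReal_nonneg _ _ _

/-- Chebyshev's inequality for a sum of n independent squares of mean one; V is the variance of one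
square. -/
theorem exists_norm_sq_stdGaussian_concentration : ∃ V : ℝ, 0 ≤ V ∧ ∀ (n : ℕ) (δ : ℝ), 0 < n → 0 < δ →
    stdGaussian (EuclideanSpace ℝ (Fin n)) {g | δ ≤ |‖g‖ ^ 2 / n - 1|} ≤
      ENNReal.ofReal (V / (n * δ ^ 2)) := by
  have hz2 : MemLp (fun z : ℝ => z ^ 2) 2 (gaussianReal 0 1) := by
    rw [memLp_two_iff_integrable_sq (by fun_prop)]
    have := (memLp_id_gaussianReal (μ := 0) (v := 1) 4).integrable_norm_pow (by norm_num)
    simpa [← pow_mul, Even.pow_abs (by decide : Even 4)] using this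
  refine ⟨Var[fun z : ℝ => z ^ 2; gaussianReal 0 1], variance_nonneg _ _, fun n δ hn hδ => ?_⟩
  have hn' : (0 : ℝ) < n := by exact_mod_cast hn
  set P := Measure.pi (fun _ : Fin n => gaussianReal 0 1)
  have hmem : ∀ i : Fin n, MemLp (fun x : Fin n → ℝ => (x i) ^ 2) 2 P := fun i =>
    hz2.comp_measurePreserving (measurePreserving_eval _ i)
  have hsum : MemLp (fun x : Fin n → ℝ => ∑ i, (x i) ^ 2) 2 P := memLp_finsetSum _ fun i _ => hmem i
  have hE : ∫ x, ∑ i, (x i) ^ 2 ∂P = n := by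
    have h1 : ∫ z, z ^ 2 ∂(gaussianReal 0 1) = 1 := by
      have := variance_fun_id_gaussianReal (μ := 0) (v := 1)
      rwa [variance_of_integral_eq_zero (by fun_prop) integral_id_gaussianReal] at this
    rw [integral_finsetSum _ fun i _ => (hmem i).integrable (by norm_num)]
    have h2 : ∀ i, ∫ x : Fin n → ℝ, (x i) ^ 2 ∂P = 1 := fun i => by
      rw [← h1]
      exact integral_comp_eval (μ := fun _ : Fin n => gaussianReal 0 1)
        (f := fun z : ℝ => z ^ 2) (by fun_prop)
    simp [h2]
  have hV : Var[fun x : Fin n → ℝ => ∑ i, (x i) ^ 2; P] =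
      n * Var[fun z : ℝ => z ^ 2; gaussianReal 0 1] := by
    have := variance_sum_pi (μ := fun _ : Fin n => gaussianReal 0 1)
      (X := fun _ z => z ^ 2) (fun i => hz2)
    simp at this
    rw [← this]; congr 1; ext x; simp
  rw [← map_pi_eq_stdGaussian, Measure.map_apply (by fun_prop)]
  · have hc := meas_ge_le_variance_div_sq hsum (c := n * δ) (by positivity)
    rw [hE, hV] at hc
    refine (measure_mono ?_).trans (hc.trans_eq ?_)
    · intro x hx
      simp only [Set.mem_preimage, Set.mem_ofPred_eq, EuclideanSpace.real_norm_sq_eq] at hx ⊢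
      rw [show ∑ i, x i ^ 2 - n = n * ((∑ i, x i ^ 2) / n - 1) by field_simp, abs_mul,
        abs_of_pos hn']
      gcongr
    · congr 1; field_simp
  · exact measurableSet_le measurable_const (by fun_prop)

theorem stdGaussian_eq_withDensity (n : ℕ) :
    stdGaussian (EuclideanSpace ℝ (Fin n)) = volume.withDensity fun x =>
      ENNReal.ofReal (((√(2 * Real.pi))⁻¹) ^ n * Real.exp (-‖x‖ ^ 2 / 2)) := by
  have hpdf : ∀ x : Fin n → ℝ, ∏ i, gaussianPDF 0 1 (x i) = ENNReal.ofReal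
      (((√(2 * Real.pi))⁻¹) ^ n * Real.exp (-‖WithLp.toLp 2 x‖ ^ 2 / 2)) := by
    intro x
    simp_rw [gaussianPDF]
    rw [← ENNReal.ofReal_prod_of_nonneg fun _ _ => gaussianPDFReal_nonneg _ _ _]
    simp_rw [gaussianPDFReal, NNReal.coe_one, mul_one, sub_zero]
    rw [Finset.prod_mul_distrib, ← Real.exp_sum, EuclideanSpace.real_norm_sq_eq]
    simp [neg_div, Finset.sum_div]
  ext S hS
  have hS' : MeasurableSet (WithLp.toLp 2 ⁻¹' S : Set (Fin n → ℝ)) :=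
    (by fun_prop : Measurable fun x : Fin n → ℝ => WithLp.toLp 2 x) hS
  rw [← map_pi_eq_stdGaussian, Measure.map_apply (by fun_prop) hS, pi_gaussianReal_eq_withDensity,
    withDensity_apply _ hS', withDensity_apply _ hS]
  simp_rw [hpdf]
  exact (PiLp.volume_preserving_toLp (Fin n)).setLIntegral_comp_preimage hS
    (f := fun x => ENNReal.ofReal (((√(2 * Real.pi))⁻¹) ^ n * Real.exp (-‖x‖ ^ 2 / 2)))
    (by fun_prop)

/-- The direction of a standard Gaussian vector is uniformly distributed on the sphere. -/
theorem stdGaussian_direction {n : ℕ} (hn : 0 < n) {T : Set (EuclideanSpace ℝ (Fin n))}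
    (hT : MeasurableSet T) :
    stdGaussian (EuclideanSpace ℝ (Fin n)) {g | ‖g‖⁻¹ • g ∈ T} = unif n (Subtype.val ⁻¹' T) := by
  have : NeZero n := ⟨hn.ne'⟩
  have : Nontrivial (EuclideanSpace ℝ (Fin n)) := by
    apply Module.nontrivial_of_finrank_pos (R := ℝ)
    simpa using hn
  set E := EuclideanSpace ℝ (Fin n) with hE
  set f : ℝ → ENNReal := fun r => ENNReal.ofReal
    (((√(2 * Real.pi))⁻¹) ^ n * Real.exp (-r ^ 2 / 2)) with hf
  have hfm : Measurable f := by fun_prop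
  -- In polar coordinates the density depends on the radius alone, so the integral factors. The
  -- radial factor c is identified by taking the whole space for S.
  set c := ∫⁻ r : Set.Ioi (0 : ℝ), f r ∂(Measure.volumeIoiPow (Module.finrank ℝ E - 1)) with hc
  have key : ∀ {S : Set E}, MeasurableSet S → stdGaussian E {g | ‖g‖⁻¹ • g ∈ S} =
      (volume : Measure E).toSphere (Subtype.val ⁻¹' S) * c := by
    intro S hS
    have hSm : MeasurableSet {g : E | ‖g‖⁻¹ • g ∈ S} :=
      (by fun_prop : Measurable fun g : E => ‖g‖⁻¹ • g) hS
    have hS' : MeasurableSet (Subtype.val ⁻¹' S : Set (USphere n)) := measurable_subtype_coe hS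
    have hprod : ∫⁻ p : USphere n × Set.Ioi (0 : ℝ), (Subtype.val ⁻¹' S).indicator 1 p.1 * f p.2
        ∂(volume : Measure E).toSphere.prod (Measure.volumeIoiPow (Module.finrank ℝ E - 1)) =
        (volume : Measure E).toSphere (Subtype.val ⁻¹' S) * c := by
      rw [lintegral_prod_mul (f := (Subtype.val ⁻¹' S).indicator 1)
        (g := fun r : Set.Ioi (0 : ℝ) => f r) (measurable_one.indicator hS').aemeasurable
        (by fun_prop), lintegral_indicator_one hS']
    rw [← hprod, ← (volume : Measure E).measurePreserving_homeomorphUnitSphereProd.lintegral_comp_emb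
      (Homeomorph.measurableEmbedding _)]
    rw [stdGaussian_eq_withDensity, withDensity_apply _ hSm, ← lintegral_indicator hSm]
    calc _ = ∫⁻ x in ({0}ᶜ : Set E), {g : E | ‖g‖⁻¹ • g ∈ S}.indicator (fun x => f ‖x‖) x := by
          rw [restrict_compl_singleton]
      _ = _ := by
          rw [← lintegral_subtype_comap (measurableSet_singleton _).compl]
          congr 1 with x
          by_cases hx : ‖(x : E)‖⁻¹ • (x : E) ∈ S <;> simp [hx]
  have h1 := key MeasurableSet.univ
  simp only [Set.mem_univ, Set.ofPred_true, measure_univ, Set.preimage_univ] at h1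
  rw [key hT, unif, Measure.smul_apply, smul_eq_mul, mul_comm]
  congr 1
  refine ENNReal.eq_inv_of_mul_eq_one_left ?_
  rw [mul_comm, ← h1]

/-! ### The Gaussian distribution function and its quantiles -/

theorem gaussianPDFReal_mul_abs_le_one {x : ℝ} : gaussianPDFReal 0 1 x * |x| ≤ 1 := by
  simp only [gaussianPDFReal, NNReal.coe_one, mul_one, sub_zero]
  have h1 : (√(2 * Real.pi))⁻¹ ≤ 1 :=
    inv_le_one_of_one_le₀ (Real.one_le_sqrt.2 (by linarith [Real.pi_gt_three]))
  have h2 : Real.exp (-x ^ 2 / 2) * |x| ≤ 1 := by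
    rw [neg_div, Real.exp_neg, inv_mul_le_iff₀ (Real.exp_pos _), mul_one]
    have := Real.add_one_le_exp (x ^ 2 / 2)
    have h3 : |x| ^ 2 = x ^ 2 := sq_abs x
    nlinarith [sq_nonneg (|x| - 1)]
  have h0 : 0 ≤ Real.exp (-x ^ 2 / 2) * |x| := by positivity
  rw [mul_assoc]
  exact mul_le_one₀ h1 h0 h2

theorem gaussianPDFReal_le_one {x : ℝ} : gaussianPDFReal 0 1 x ≤ 1 := by
  simp only [gaussianPDFReal, NNReal.coe_one, mul_one, sub_zero]
  have h1 : (√(2 * Real.pi))⁻¹ ≤ 1 :=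
    inv_le_one_of_one_le₀ (Real.one_le_sqrt.2 (by linarith [Real.pi_gt_three]))
  refine mul_le_one₀ h1 (Real.exp_pos _).le (Real.exp_le_one_iff.2 ?_)
  have := sq_nonneg x
  linarith

theorem gaussianReal_Iic_sub_le {a b c : ℝ} (hab : a ≤ b)
    (hc : ∀ x ∈ Set.Ioc a b, gaussianPDFReal 0 1 x ≤ c) :
    (gaussianReal 0 1).real (Set.Iic b) - (gaussianReal 0 1).real (Set.Iic a) ≤ c * (b - a) := by
  rw [← measureReal_sdiff (Set.Iic_subset_Iic.2 hab) measurableSet_Iic, Set.Iic_sdiff_Iic, measureReal_def,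
    gaussianReal_apply_eq_integral _ one_ne_zero,
    ENNReal.toReal_ofReal (integral_nonneg fun _ => gaussianPDFReal_nonneg _ _ _)]
  calc _ ≤ ∫ x in Set.Ioc a b, c := setIntegral_mono_on
        (integrable_gaussianPDFReal _ _).integrableOn (by simp) measurableSet_Ioc hc
    _ = _ := by simp [hab, mul_comm]

theorem monotone_measureReal_Iic (P : Measure ℝ) [IsFiniteMeasure P] :
    Monotone fun t => P.real (Set.Iic t) :=
  fun _ _ h => measureReal_mono (Set.Iic_subset_Iic.2 h)

theorem continuous_gaussianReal_Iic : Continuous fun t => (gaussianReal 0 1).real (Set.Iic t) := by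
  have : LipschitzWith 1 fun t => (gaussianReal 0 1).real (Set.Iic t) := by
    refine LipschitzWith.of_le_add fun x y => ?_
    rcases le_total x y with h | h
    · exact (monotone_measureReal_Iic _ h).trans (le_add_of_nonneg_right dist_nonneg)
    · have := gaussianReal_Iic_sub_le h fun _ _ => gaussianPDFReal_le_one
      rw [Real.dist_eq, abs_of_nonneg (by linarith)]
      linarith
  exact this.continuous

theorem exists_gaussianReal_Iic_eq {p : ℝ} (h0 : 0 < p) (h1 : p < 1) :
    ∃ t, (gaussianReal 0 1).real (Set.Iic t) = p := by
  have hb := tendsto_cdf_atBot (gaussianReal 0 1)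
  have ht := tendsto_cdf_atTop (gaussianReal 0 1)
  obtain ⟨a, ha⟩ := (hb.eventually (gt_mem_nhds h0)).exists
  obtain ⟨b, hb⟩ := (ht.eventually (lt_mem_nhds h1)).exists
  rw [cdf_eq_real] at ha hb
  obtain ⟨t, ht⟩ := mem_range_of_exists_le_of_exists_ge continuous_gaussianReal_Iic ⟨a, ha.le⟩ ⟨b, hb.le⟩
  exact ⟨t, ht⟩

/-- The Gaussian distribution function is stable under rescaling of its argument. -/
theorem abs_gaussianReal_Iic_mul_sub_le {R : ℝ} (hR : 0 ≤ R) (u : ℝ) :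
    |(gaussianReal 0 1).real (Set.Iic (R * u)) - (gaussianReal 0 1).real (Set.Iic u)| ≤
      2 * |R ^ 2 - 1| := by
  have hR1 : |R - 1| ≤ |R ^ 2 - 1| := by
    rw [show R ^ 2 - 1 = (R + 1) * (R - 1) by ring, abs_mul]
    refine le_mul_of_one_le_left (abs_nonneg _) ?_
    rw [abs_of_nonneg (by linarith)]; linarith
  suffices h : |(gaussianReal 0 1).real (Set.Iic (R * u)) - (gaussianReal 0 1).real (Set.Iic u)| ≤
      2 * |R - 1| by linarith
  -- For R < 1/2 the bound is at least 1. Otherwise every x between u and Ru has |x| ≥ |u|/2, so the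
  -- density there is at most 2/|u|, which cancels the factor |u| in the length of the interval.
  rcases lt_or_ge R (1 / 2) with h | h
  · have h1 : (1 : ℝ) ≤ 2 * |R - 1| := by rw [abs_of_nonpos (by linarith)]; linarith
    refine le_trans ?_ h1
    have h0 : ∀ t, (0 : ℝ) ≤ (gaussianReal 0 1).real (Set.Iic t) := fun _ => measureReal_nonneg
    have h2 : ∀ t, (gaussianReal 0 1).real (Set.Iic t) ≤ 1 := fun _ => measureReal_le_one
    rw [abs_le]
    constructor <;> linarith [h0 u, h0 (R * u), h2 u, h2 (R * u)]
  · have key : ∀ x ∈ Set.uIoc u (R * u), gaussianPDFReal 0 1 x * |u| ≤ 2 := by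
      intro x hx
      have hxu : |u| ≤ 2 * |x| := by
        rcases le_total 0 u with hu | hu
        · have : u / 2 ≤ x := by
            have h2 : u / 2 ≤ R * u := by nlinarith
            rcases Set.mem_uIoc.1 hx with ⟨h3, h4⟩ | ⟨h3, h4⟩ <;> linarith
          rw [abs_of_nonneg hu, abs_of_nonneg (by linarith)]; linarith
        · have : x ≤ u / 2 := by
            have h2 : R * u ≤ u / 2 := by nlinarith
            rcases Set.mem_uIoc.1 hx with ⟨h3, h4⟩ | ⟨h3, h4⟩ <;> linarith
          rw [abs_of_nonpos hu, abs_of_nonpos (by linarith)]; linarith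
      have := mul_le_mul_of_nonneg_left hxu (gaussianPDFReal_nonneg 0 1 x)
      linarith [gaussianPDFReal_mul_abs_le_one (x := x)]
    rcases eq_or_ne u 0 with rfl | hu
    · simp
    have hu' := abs_pos.2 hu
    have key' : ∀ x ∈ Set.uIoc u (R * u), gaussianPDFReal 0 1 x ≤ 2 / |u| := fun x hx =>
      (le_div_iff₀ hu').2 (key x hx)
    have e : 2 / |u| * |R * u - u| = 2 * |R - 1| := by
      rw [show R * u - u = (R - 1) * u by ring, abs_mul]; field_simp
    rw [← e]
    rcases le_total u (R * u) with h' | h'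
    · rw [Set.uIoc_of_le h'] at key'
      rw [abs_of_nonneg (sub_nonneg.2 (monotone_measureReal_Iic _ h')), abs_of_nonneg (sub_nonneg.2 h')]
      exact gaussianReal_Iic_sub_le h' key'
    · rw [Set.uIoc_of_ge h'] at key'
      rw [abs_of_nonpos (sub_nonpos.2 (monotone_measureReal_Iic _ h')), abs_of_nonpos (sub_nonpos.2 h'),
        neg_sub, neg_sub]
      exact gaussianReal_Iic_sub_le h' key'

/-- Comparison of distribution functions at the Gaussian quantiles controls the uniform
distance. -/
theorem exists_gaussian_quantile_grid (N : ℕ) (hN : 0 < N) :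
    ∃ q : ℕ → ℝ, ∀ (P : Measure ℝ) [IsProbabilityMeasure P] (δ : ℝ), 0 ≤ δ →
      (∀ i < N, |P.real (Set.Iic (q i)) - (gaussianReal 0 1).real (Set.Iic (q i))| ≤ δ) →
      ∀ u, |P.real (Set.Iic u) - (gaussianReal 0 1).real (Set.Iic u)| ≤ δ + 1 / N := by
  have hN' : (0 : ℝ) < N := by exact_mod_cast hN
  -- Only 0 < i < N give quantiles; the other values of q are arbitrary and never used below.
  have hq : ∀ i : ℕ, ∃ t, 0 < i → i < N → (gaussianReal 0 1).real (Set.Iic t) = i / N := by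
    intro i
    by_cases hi : 0 < i ∧ i < N
    · obtain ⟨t, ht⟩ := exists_gaussianReal_Iic_eq (p := i / N)
        (div_pos (by exact_mod_cast hi.1) hN')
        ((div_lt_one hN').2 (by exact_mod_cast hi.2))
      exact ⟨t, fun _ _ => ht⟩
    · exact ⟨0, fun h1 h2 => (hi ⟨h1, h2⟩).elim⟩
  choose q hq using hq
  refine ⟨q, fun P _ δ hδ hP u => ?_⟩
  set Φ : ℝ → ℝ := fun t => (gaussianReal 0 1).real (Set.Iic t) with hΦ
  set F : ℝ → ℝ := fun t => P.real (Set.Iic t) with hF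
  change |F u - Φ u| ≤ _
  have hΦm : Monotone Φ := monotone_measureReal_Iic _
  have hFm : Monotone F := monotone_measureReal_Iic _
  have hΦ0 : 0 ≤ Φ u := measureReal_nonneg
  have hΦ1 : Φ u ≤ 1 := measureReal_le_one
  have hF0 : 0 ≤ F u := measureReal_nonneg
  have hF1 : F u ≤ 1 := measureReal_le_one
  set k := ⌊N * Φ u⌋₊
  have hk1 : (k : ℝ) ≤ N * Φ u := Nat.floor_le (by positivity)
  have hk2 : N * Φ u < k + 1 := Nat.lt_floor_add_one _
  have hk1' : (k : ℝ) / N ≤ Φ u := by rw [div_le_iff₀ hN']; linarith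
  have hk2' : Φ u < k / N + 1 / N := by rw [← add_div, lt_div_iff₀ hN']; linarith
  have hN1 : 0 ≤ 1 / (N : ℝ) := by positivity
  rw [abs_le]
  constructor
  · rcases hΦ0.eq_or_lt with h0 | h0
    · linarith
    -- The ceiling gives the strict inequality j/N < Φ(u), which yields both j < N and q j ≤ u; the
    -- floor k could satisfy k/N = Φ(u).
    obtain ⟨j, hj⟩ : ∃ j, ⌈N * Φ u⌉₊ = j + 1 :=
      Nat.exists_eq_succ_of_ne_zero (Nat.ceil_pos.2 (by positivity)).ne'
    have hj1 : N * Φ u ≤ j + 1 := by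
      have := Nat.le_ceil (N * Φ u)
      rw [hj] at this
      exact_mod_cast this
    have hj2 : (j : ℝ) < N * Φ u := Nat.lt_ceil.1 (by omega)
    have hj1' : Φ u ≤ j / N + 1 / N := by rw [← add_div, le_div_iff₀ hN']; linarith
    have hj2' : (j : ℝ) / N < Φ u := by rw [div_lt_iff₀ hN']; linarith
    have hjN : j < N := by
      have : (j : ℝ) < N := hj2.trans_le (mul_le_of_le_one_right hN'.le hΦ1)
      exact_mod_cast this
    rcases Nat.eq_zero_or_pos j with hz | hz
    · rw [hz, Nat.cast_zero, zero_div] at hj1'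
      linarith
    · have h1 : Φ (q j) = j / N := hq j hz hjN
      have h2 : q j ≤ u := by
        by_contra! h
        linarith [hΦm h.le]
      have h3 : -δ ≤ F (q j) - Φ (q j) := (abs_le.1 (hP _ hjN)).1
      linarith [hFm h2]
  · rcases lt_or_ge (k + 1) N with hkN | hkN
    · have h1 : Φ (q (k + 1)) = (k + 1 : ℕ) / N := hq (k + 1) (by omega) hkN
      rw [Nat.cast_add, Nat.cast_one, add_div] at h1
      have h2 : u ≤ q (k + 1) := by
        by_contra! h
        linarith [hΦm h.le]
      have h3 : F (q (k + 1)) - Φ (q (k + 1)) ≤ δ := (abs_le.1 (hP _ hkN)).2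
      linarith [hFm h2]
    · have : (N : ℝ) ≤ k + 1 := by exact_mod_cast hkN
      have h1 : 1 ≤ (k : ℝ) / N + 1 / N := by rw [← add_div, le_div_iff₀ hN']; linarith
      linarith

/-! ### Concentration for random linear combinations -/

theorem integral_measureReal_swap {α β : Type*} [MeasurableSpace α] [MeasurableSpace β]
    (μ : Measure α) (ν : Measure β) [IsFiniteMeasure μ] [IsFiniteMeasure ν] {S : Set (α × β)}
    (hS : MeasurableSet S) :
    ∫ x, ν.real {y | (x, y) ∈ S} ∂μ = ∫ y, μ.real {x | (x, y) ∈ S} ∂ν := by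
  have h := integral_integral_swap (μ := μ) (ν := ν)
    (f := fun x y => S.indicator (fun _ => (1 : ℝ)) (x, y))
    ((integrable_indicator_iff hS).2 (integrable_const _).integrableOn)
  have h1 : ∀ x, ∫ y, S.indicator (fun _ => (1 : ℝ)) (x, y) ∂ν = ν.real {y | (x, y) ∈ S} := by
    intro x
    rw [show {y | (x, y) ∈ S} = Prod.mk x ⁻¹' S from rfl,
      ← integral_indicator_one (measurable_prodMk_left hS)]
    rfl
  have h2 : ∀ y, ∫ x, S.indicator (fun _ => (1 : ℝ)) (x, y) ∂μ = μ.real {x | (x, y) ∈ S} := by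
    intro y
    rw [show {x | (x, y) ∈ S} = (fun x => (x, y)) ⁻¹' S from rfl,
      ← integral_indicator_one (measurable_prodMk_right hS)]
    rfl
  simpa only [h1, h2] using h

/-- Concentration of the distribution function of a Gaussian linear combination of nearly
uncorrelated unit vectors. -/
theorem exists_gaussian_cdf_concentration :
    ∃ K : ℝ, 0 ≤ K ∧ ∀ (E : Type) [NormedAddCommGroup E] [InnerProductSpace ℝ E]
      [FiniteDimensional ℝ E] [MeasurableSpace E] [BorelSpace E] (n : ℕ) (Ω : Type)
      [MeasurableSpace Ω] (σ : Measure Ω) [IsProbabilityMeasure σ] (y : Ω → E) (t δ : ℝ), 0 < n → 0 < δ →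
      Measurable y → (∀ x, ‖y x‖ = 1) →
      ∫ p : Ω × Ω, inner ℝ (y p.1) (y p.2) ∂(σ.prod σ) ≤ 1 / n →
      ∫ p : Ω × Ω, inner ℝ (y p.1) (y p.2) ^ 2 ∂(σ.prod σ) ≤ 1 / n →
      stdGaussian E
        {g | δ ≤ |σ.real {x | inner ℝ (y x) g ≤ t} - (gaussianReal 0 1).real (Set.Iic t)|} ≤
        ENNReal.ofReal (K / (n * δ ^ 2)) := by
  obtain ⟨K, c, hc0, hcK, H⟩ := exists_stdGaussian_inner_inner_le
  refine ⟨2 * K, by linarith [hc0 0, hcK 0], ?_⟩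
  intro E _ _ _ _ _ n Ω _ σ _ y t δ hn hδ hy hy1 h1 h2
  have hn' : (0 : ℝ) < n := by exact_mod_cast hn
  set γ := stdGaussian E with hγ
  set F : E → ℝ := fun g => σ.real {x | inner ℝ (y x) g ≤ t} with hF
  set Φ := (gaussianReal 0 1).real (Set.Iic t) with hΦ
  have hS : MeasurableSet {p : E × Ω | inner ℝ (y p.2) p.1 ≤ t} :=
    measurableSet_le (by fun_prop) measurable_const
  have hFm : Measurable F := (measurable_measure_prodMk_left hS).ennreal_toReal
  have hF1 : ∀ g, ‖F g‖ ≤ 1 := fun g => by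
    rw [Real.norm_of_nonneg measureReal_nonneg]; exact measureReal_le_one
  have hF2 : MemLp F 2 γ := MemLp.of_bound hFm.aestronglyMeasurable 1 (ae_of_all _ hF1)
  have hmean : ∫ g, F g ∂γ = Φ := by
    refine (integral_measureReal_swap γ σ hS).trans ?_
    have : ∀ x, γ.real {g | (g, x) ∈ {p : E × Ω | inner ℝ (y p.2) p.1 ≤ t}} = Φ := by
      intro x
      rw [hΦ, ← map_inner_stdGaussian (hy1 x), map_measureReal_apply (by fun_prop) measurableSet_Iic]
      rfl
    simp_rw [this]
    simp
  have hρm : Measurable fun p : Ω × Ω => (inner ℝ (y p.1) (y p.2) : ℝ) := by fun_prop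
  have hρ1 : ∀ p : Ω × Ω, ‖(inner ℝ (y p.1) (y p.2) : ℝ)‖ ≤ 1 := fun p => by
    simpa [hy1] using norm_inner_le_norm (𝕜 := ℝ) (y p.1) (y p.2)
  have hi1 : Integrable (fun p : Ω × Ω => (inner ℝ (y p.1) (y p.2) : ℝ)) (σ.prod σ) :=
    Integrable.of_bound hρm.aestronglyMeasurable 1 (ae_of_all _ hρ1)
  have hi2 : Integrable (fun p : Ω × Ω => (inner ℝ (y p.1) (y p.2) : ℝ) ^ 2) (σ.prod σ) :=
    Integrable.of_bound (hρm.pow_const 2).aestronglyMeasurable 1 (ae_of_all _ fun p => by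
      rw [norm_pow]; exact pow_le_one₀ (norm_nonneg _) (hρ1 p))
  -- F(g)² is the σ ⊗ σ measure of the pairs with both inner products at most t, so Fubini reduces
  -- its mean to the bivariate bound.
  have hsq : ∫ g, F g ^ 2 ∂γ ≤ Φ ^ 2 + 2 * K / n := by
    have hS2 : MeasurableSet {p : E × Ω × Ω |
        inner ℝ (y p.2.1) p.1 ≤ t ∧ inner ℝ (y p.2.2) p.1 ≤ t} :=
      (measurableSet_le (f := fun p : E × Ω × Ω => inner ℝ (y p.2.1) p.1) (by fun_prop)
        measurable_const).inter (measurableSet_le (f := fun p : E × Ω × Ω => inner ℝ (y p.2.2) p.1)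
          (by fun_prop) measurable_const)
    have e : ∀ g, F g ^ 2 = (σ.prod σ).real {q | (g, q) ∈ {p : E × Ω × Ω |
        inner ℝ (y p.2.1) p.1 ≤ t ∧ inner ℝ (y p.2.2) p.1 ≤ t}} := by
      intro g
      rw [sq, hF, ← measureReal_prod_prod]
      rfl
    simp_rw [e]
    rw [integral_measureReal_swap γ (σ.prod σ) hS2]
    calc _ ≤ ∫ p : Ω × Ω, (Φ ^ 2 + c t * inner ℝ (y p.1) (y p.2) +
            K * inner ℝ (y p.1) (y p.2) ^ 2) ∂(σ.prod σ) := by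
          apply integral_mono_of_nonneg (ae_of_all _ fun _ => measureReal_nonneg)
          · exact ((integrable_const _).add (hi1.const_mul _)).add (hi2.const_mul _)
          · exact ae_of_all _ fun p => H E t _ _ (hy1 p.1) (hy1 p.2)
      _ = Φ ^ 2 + c t * ∫ p : Ω × Ω, inner ℝ (y p.1) (y p.2) ∂(σ.prod σ) +
            K * ∫ p : Ω × Ω, inner ℝ (y p.1) (y p.2) ^ 2 ∂(σ.prod σ) := by
          rw [integral_add (by exact (integrable_const _).add (hi1.const_mul _))
            (hi2.const_mul _), integral_add (integrable_const _) (hi1.const_mul _),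
            integral_const_mul, integral_const_mul]
          simp
      _ ≤ Φ ^ 2 + K * (1 / n) + K * (1 / n) := by
          have a1 := mul_le_mul_of_nonneg_left h1 (hc0 t)
          have a2 : c t * (1 / n) ≤ K * (1 / n) := by gcongr; exact hcK t
          have a3 := mul_le_mul_of_nonneg_left h2 ((hc0 t).trans (hcK t))
          linarith
      _ = _ := by ring
  have hvar : Var[F; γ] ≤ 2 * K / n := by
    rw [variance_eq_sub hF2]
    simp only [Pi.pow_apply, hmean]
    linarith
  have := meas_ge_le_variance_div_sq hF2 hδ
  rw [hmean] at this
  refine this.trans (ENNReal.ofReal_le_ofReal ?_)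
  rw [← div_div]
  gcongr

theorem kolDist_le {P Q : Measure ℝ} {ε : ℝ}
    (h : ∀ u, |P.real (Set.Iic u) - Q.real (Set.Iic u)| ≤ ε) : kolDist P Q ≤ ε :=
  ciSup_le h

/-- A central limit theorem with rate for a random direction in a nearly uncorrelated family of
vectors. -/
theorem exists_kolDist_concentration :
    ∃ C : ℝ, 0 ≤ C ∧ ∀ (n : ℕ) (Ω : Type) [MeasurableSpace Ω] (σ : Measure Ω)
      [IsProbabilityMeasure σ] (y : Ω → EuclideanSpace ℝ (Fin n)) (ε : ℝ), 0 < n → 0 < ε →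
      Measurable y → (∀ x, ‖y x‖ = 1) →
      ∫ p : Ω × Ω, inner ℝ (y p.1) (y p.2) ∂(σ.prod σ) ≤ 1 / n →
      ∫ p : Ω × Ω, inner ℝ (y p.1) (y p.2) ^ 2 ∂(σ.prod σ) ≤ 1 / n →
      unif n {α | ε < kolDist (σ.map fun x => √n * inner ℝ (y x) (α : EuclideanSpace ℝ (Fin n)))
        (gaussianReal 0 1)} ≤ ENNReal.ofReal (C * (1 / (n * ε ^ 3))) := by
  obtain ⟨K, hK0, HK⟩ := exists_gaussian_cdf_concentration
  obtain ⟨V, hV0, HV⟩ := exists_norm_sq_stdGaussian_concentration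
  -- 256 = 16² comes from deviations of size ε/16, and 17/ε bounds the number N of grid points.
  refine ⟨256 * (17 * K + V), by positivity, ?_⟩
  intro n Ω _ σ _ y ε hn hε hy hy1 h1 h2
  have hn' : (0 : ℝ) < n := by exact_mod_cast hn
  have hsn : 0 < √(n : ℝ) := Real.sqrt_pos.2 hn'
  set Φ : ℝ → ℝ := fun t => (gaussianReal 0 1).real (Set.Iic t) with hΦ
  have hprob : ∀ f : Ω → ℝ, Measurable f → IsProbabilityMeasure (σ.map f) := fun f hf =>
    Measure.isProbabilityMeasure_map hf.aemeasurable
  have hmeas : ∀ a : EuclideanSpace ℝ (Fin n), Measurable fun x => √n * inner ℝ (y x) a := fun a => by fun_prop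
  -- The Kolmogorov distance never exceeds 1, so ε > 1 gives the empty event.
  rcases lt_or_ge 1 ε with hε1 | hε1
  · rw [Set.eq_empty_of_forall_notMem (s := {α : USphere n | _})]
    · simp
    · intro α hα
      have := hprob _ (hmeas α)
      refine absurd hα (not_lt.2 ((kolDist_le fun u => ?_).trans hε1.le))
      have a0 : 0 ≤ (σ.map fun x => √n * inner ℝ (y x) (α : EuclideanSpace ℝ (Fin n))).real (Set.Iic u) := measureReal_nonneg
      have a1 : (σ.map fun x => √n * inner ℝ (y x) (α : EuclideanSpace ℝ (Fin n))).real (Set.Iic u) ≤ 1 := measureReal_le_one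
      have b0 : 0 ≤ (gaussianReal 0 1).real (Set.Iic u) := measureReal_nonneg
      have b1 : (gaussianReal 0 1).real (Set.Iic u) ≤ 1 := measureReal_le_one
      rw [abs_le]; constructor <;> linarith
  set N := ⌈16 / ε⌉₊ with hN
  have hNpos : 0 < N := Nat.ceil_pos.2 (by positivity)
  have hNpos' : (0 : ℝ) < N := by exact_mod_cast hNpos
  have hN1 : 1 / (N : ℝ) ≤ ε / 16 := by
    rw [div_le_div_iff₀ hNpos' (by norm_num)]
    have := Nat.le_ceil (16 / ε)
    rw [div_le_iff₀ hε] at this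
    linarith
  have hN2 : (N : ℝ) ≤ 17 / ε := by
    have := (Nat.ceil_lt_add_one (by positivity : 0 ≤ 16 / ε)).le
    have h3 : 1 ≤ 1 / ε := by rw [le_div_iff₀ hε]; linarith
    calc (N : ℝ) ≤ 16 / ε + 1 / ε := by linarith
      _ = 17 / ε := by ring
  obtain ⟨q, hq⟩ := exists_gaussian_quantile_grid N hNpos
  -- Off T the grid gives distance at most ε/2 + 1/N ≤ ε. T is a finite union of measurable sets, as
  -- `stdGaussian_direction` requires.
  set T : Set (EuclideanSpace ℝ (Fin n)) := {a | ∃ i < N, ε / 2 < |σ.real {x | √n * inner ℝ (y x) a ≤ q i} - Φ (q i)|}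
    with hT
  have hTm : MeasurableSet T := by
    have : T = ⋃ i < N, {a | ε / 2 < |σ.real {x | √n * inner ℝ (y x) a ≤ q i} - Φ (q i)|} := by
      ext a; simp [hT]
    rw [this]
    refine .biUnion (Set.to_countable _) fun i _ => ?_
    have hS : MeasurableSet {p : EuclideanSpace ℝ (Fin n) × Ω | √n * inner ℝ (y p.2) p.1 ≤ q i} :=
      measurableSet_le (by fun_prop) measurable_const
    have hFm : Measurable fun a : EuclideanSpace ℝ (Fin n) => σ.real {x | √n * inner ℝ (y x) a ≤ q i} :=
      (measurable_measure_prodMk_left hS).ennreal_toReal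
    exact measurableSet_lt measurable_const (by fun_prop)
  have hsub : {α : USphere n | ε < kolDist (σ.map fun x => √n * inner ℝ (y x) (α : EuclideanSpace ℝ (Fin n)))
      (gaussianReal 0 1)} ⊆ Subtype.val ⁻¹' T := by
    intro α hα
    by_contra hαT
    have := hprob _ (hmeas α)
    refine absurd hα (not_lt.2 (kolDist_le fun u => ?_))
    refine (hq _ (ε / 2) (by positivity) (fun i hi => ?_) u).trans (by linarith)
    rw [map_measureReal_apply (hmeas _) measurableSet_Iic]
    by_contra! h
    exact hαT ⟨i, hi, h⟩
  refine (measure_mono hsub).trans ?_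
  rw [← stdGaussian_direction hn hTm]
  -- Normalizing g moves the threshold q i to R q i with R = |g|/√n. If all listed deviations are
  -- below ε/16, the total error is at most ε/16 + 1/N + 2ε/16 ≤ ε/4, contradicting membership in T.
  have hcover : {g : EuclideanSpace ℝ (Fin n) | ‖g‖⁻¹ • g ∈ T} ⊆
      (⋃ i ∈ Finset.range N, {g | ε / 16 ≤ |σ.real {x | inner ℝ (y x) g ≤ q i} - Φ (q i)|}) ∪
        {g | ε / 16 ≤ |‖g‖ ^ 2 / n - 1|} := by
    intro g hg
    by_contra hcon
    simp only [Set.mem_union, Set.mem_iUnion, Set.mem_ofPred_eq, Finset.mem_range, not_or,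
      not_exists, not_le] at hcon
    obtain ⟨hgrid, hnorm⟩ := hcon
    obtain ⟨i, hi, hgi⟩ := hg
    have hg0 : 0 < ‖g‖ := by
      rw [norm_pos_iff]
      rintro rfl
      simp at hnorm
      linarith
    set R := ‖g‖ / √n with hR
    have hR0 : 0 < R := by positivity
    have hR2 : R ^ 2 = ‖g‖ ^ 2 / n := by rw [hR, div_pow, Real.sq_sqrt hn'.le]
    have hset : {x | √n * inner ℝ (y x) (‖g‖⁻¹ • g) ≤ q i} = {x | inner ℝ (y x) g ≤ R * q i} := by
      ext x
      simp only [Set.mem_ofPred_eq, inner_smul_right]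
      rw [show √(n : ℝ) * (‖g‖⁻¹ * inner ℝ (y x) g) = inner ℝ (y x) g / R by
        rw [hR]; field_simp, div_le_iff₀ hR0, mul_comm]
    rw [hset] at hgi
    have hgm : Measurable fun x => (inner ℝ (y x) g : ℝ) := by fun_prop
    have := hprob _ hgm
    -- R q i depends on g and need not be a quantile of the grid, so the grid estimate is applied a
    -- second time.
    have a1 := hq (σ.map fun x => inner ℝ (y x) g) (ε / 16) (by positivity) (fun j hj => by
      rw [map_measureReal_apply hgm measurableSet_Iic]
      exact (hgrid j hj).le) (R * q i)
    rw [map_measureReal_apply hgm measurableSet_Iic] at a1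
    have a2 := abs_gaussianReal_Iic_mul_sub_le hR0.le (q i)
    rw [hR2] at a2
    have a3 := abs_sub_le (σ.real {x | inner ℝ (y x) g ≤ R * q i}) (Φ (R * q i)) (Φ (q i))
    have a1' : |σ.real {x | inner ℝ (y x) g ≤ R * q i} - Φ (R * q i)| ≤ ε / 16 + 1 / N := a1
    have a2' : |Φ (R * q i) - Φ (q i)| ≤ 2 * |‖g‖ ^ 2 / n - 1| := a2
    linarith
  refine (measure_mono hcover).trans ((measure_union_le _ _).trans ?_)
  calc _ ≤ (∑ i ∈ Finset.range N, ENNReal.ofReal (K / (n * (ε / 16) ^ 2))) +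
        ENNReal.ofReal (V / (n * (ε / 16) ^ 2)) := by
        refine add_le_add ((measure_biUnion_finset_le _ _).trans
          (Finset.sum_le_sum fun i _ => ?_)) (HV n _ hn (by positivity))
        exact HK _ n Ω σ y (q i) _ hn (by positivity) hy hy1 h1 h2
    _ = ENNReal.ofReal (N * (K / (n * (ε / 16) ^ 2)) + V / (n * (ε / 16) ^ 2)) := by
        rw [ENNReal.ofReal_add (by positivity) (by positivity), Finset.sum_const,
          Finset.card_range, nsmul_eq_mul, ENNReal.ofReal_mul (by positivity),
          ENNReal.ofReal_natCast]
    _ ≤ _ := by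
        apply ENNReal.ofReal_le_ofReal
        have e1 : N * (K / (n * (ε / 16) ^ 2)) ≤ 17 / ε * (K / (n * (ε / 16) ^ 2)) := by gcongr
        have e2 : V / (n * (ε / 16) ^ 2) ≤ 1 / ε * (V / (n * (ε / 16) ^ 2)) := by
          apply le_mul_of_one_le_left (by positivity)
          rw [le_div_iff₀ hε]; linarith
        have e3 : 17 / ε * (K / (n * (ε / 16) ^ 2)) + 1 / ε * (V / (n * (ε / 16) ^ 2)) =
            256 * (17 * K + V) * (1 / (n * ε ^ 3)) := by
          field_simp
          ring
        linarith

/-! ### Rotation invariance and the addition theorem -/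

/-- The action of a linear isometry on the unit sphere. -/
def sphereMap {k : ℕ} (O : EuclideanSpace ℝ (Fin k) ≃ₗᵢ[ℝ] EuclideanSpace ℝ (Fin k))
    (x : USphere k) : USphere k :=
  ⟨O x, by simp⟩

theorem continuous_sphereMap {k : ℕ}
    (O : EuclideanSpace ℝ (Fin k) ≃ₗᵢ[ℝ] EuclideanSpace ℝ (Fin k)) : Continuous (sphereMap O) :=
  (O.continuous.comp continuous_subtype_val).subtype_mk _

theorem exists_sphereMap_eq {k : ℕ} (x y : USphere k) :
    ∃ O : EuclideanSpace ℝ (Fin k) ≃ₗᵢ[ℝ] EuclideanSpace ℝ (Fin k), sphereMap O x = y :=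
  ⟨_, Subtype.ext (Submodule.reflection_sub (v := (x : EuclideanSpace ℝ (Fin k)))
    (w := (y : EuclideanSpace ℝ (Fin k))) (by simp))⟩

/-- Inherited from the invariance of the standard Gaussian, whose direction is uniform. -/
theorem measurePreserving_sphereMap {k : ℕ} (hk : 0 < k)
    (O : EuclideanSpace ℝ (Fin k) ≃ₗᵢ[ℝ] EuclideanSpace ℝ (Fin k)) :
    MeasurePreserving (sphereMap O) (unif k) (unif k) := by
  refine ⟨(continuous_sphereMap O).measurable, ?_⟩
  ext s hs
  rw [Measure.map_apply (continuous_sphereMap O).measurable hs]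
  have hT : MeasurableSet (Subtype.val '' s : Set (EuclideanSpace ℝ (Fin k))) :=
    Metric.isClosed_sphere.measurableSet.subtype_image hs
  have h1 : s = Subtype.val ⁻¹' (Subtype.val '' s : Set (EuclideanSpace ℝ (Fin k))) :=
    (Set.preimage_image_eq _ Subtype.val_injective).symm
  have h2 : sphereMap O ⁻¹' s = Subtype.val ⁻¹' (O ⁻¹' (Subtype.val '' s)) := by
    rw [h1]; ext x; simp [sphereMap]
  have h3 : MeasurableSet {g : EuclideanSpace ℝ (Fin k) | ‖g‖⁻¹ • g ∈ (Subtype.val '' s)} :=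
    (by fun_prop : Measurable fun g : EuclideanSpace ℝ (Fin k) => ‖g‖⁻¹ • g) hT
  conv_rhs => rw [h1]
  rw [h2, ← stdGaussian_direction hk (O.continuous.measurable hT), ← stdGaussian_direction hk hT]
  conv_rhs => rw [← stdGaussian_map O, Measure.map_apply O.continuous.measurable h3]
  congr 1
  ext g
  simp

/-- The Laplacian is a trace and may be computed in any orthonormal basis, in particular in the
image under O of the standard one. -/
theorem laplacian_comp_linearIsometryEquiv {E : Type*} [NormedAddCommGroup E]
    [InnerProductSpace ℝ E] [FiniteDimensional ℝ E] (O : E ≃ₗᵢ[ℝ] E) (F : E → ℝ) (x : E) :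
    Laplacian.laplacian (F ∘ O) x = Laplacian.laplacian F (O x) := by
  rw [InnerProductSpace.laplacian_eq_iteratedFDeriv_stdOrthonormalBasis,
    InnerProductSpace.laplacian_eq_iteratedFDeriv_orthonormalBasis F
      ((stdOrthonormalBasis ℝ E).map O)]
  refine Finset.sum_congr rfl fun i _ => ?_
  have := O.toContinuousLinearEquiv.iteratedFDerivWithin_comp_right F uniqueDiffOn_univ
    (x := x) (Set.mem_univ _) 2
  simp only [Set.preimage_univ, iteratedFDerivWithin_univ] at this
  change iteratedFDeriv ℝ 2 (F ∘ O.toContinuousLinearEquiv) x _ = _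
  rw [this]
  simp only [ContinuousMultilinearMap.compContinuousLinearMap_apply]
  congr 1
  ext j
  fin_cases j <;> simp

section Harmonic

variable {d ℓ : ℕ}

theorem radialExt_coe (f : USphere (d + 1) → ℝ) (x : USphere (d + 1)) :
    radialExt f (x : EuclideanSpace ℝ (Fin (d + 1))) = f x := by
  have hx : (x : EuclideanSpace ℝ (Fin (d + 1))) ≠ 0 := ne_zero_of_mem_unit_sphere x
  rw [radialExt, dif_neg hx]
  congr 1
  ext1
  simp

theorem radialExt_comp_sphereMap
    (O : EuclideanSpace ℝ (Fin (d + 1)) ≃ₗᵢ[ℝ] EuclideanSpace ℝ (Fin (d + 1)))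
    (f : USphere (d + 1) → ℝ) : radialExt (f ∘ sphereMap O) = radialExt f ∘ O := by
  ext x
  by_cases hx : x = 0
  · simp [radialExt, hx]
  · have : O x ≠ 0 := by simpa using hx
    simp only [radialExt, Function.comp, dif_neg hx, dif_neg this]
    congr 1
    ext1
    simp [sphereMap]

theorem SmoothOnSphere.continuous {f : USphere (d + 1) → ℝ} (hf : SmoothOnSphere f) :
    Continuous f := by
  have h : f = radialExt f ∘ Subtype.val := by ext x; exact (radialExt_coe f x).symm
  rw [h]
  exact hf.continuousOn.comp_continuous continuous_subtype_val fun x =>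
    ne_zero_of_mem_unit_sphere x

theorem IsHarmonic.comp_sphereMap {f : USphere (d + 1) → ℝ} (hf : IsHarmonic d ℓ f)
    (O : EuclideanSpace ℝ (Fin (d + 1)) ≃ₗᵢ[ℝ] EuclideanSpace ℝ (Fin (d + 1))) :
    IsHarmonic d ℓ (f ∘ sphereMap O) := by
  constructor
  · rw [SmoothOnSphere, radialExt_comp_sphereMap]
    refine ContDiffOn.comp hf.1 O.contDiff.contDiffOn fun x hx => ?_
    simpa using hx
  · intro x
    rw [laplaceBeltrami, radialExt_comp_sphereMap, laplacian_comp_linearIsometryEquiv]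
    exact hf.2 (sphereMap O x)

theorem integrable_unif_of_continuous {k : ℕ} (hk : 0 < k) {f : USphere k → ℝ}
    (hf : Continuous f) : Integrable f (unif k) := by
  have := isProbabilityMeasure_unif hk
  rw [← integrableOn_univ]
  exact hf.continuousOn.integrableOn_compact isCompact_univ

variable {Y : Fin (harmDim ℓ d) → USphere (d + 1) → ℝ}

theorem IsHarmonicONB.continuous (hY : IsHarmonicONB d ℓ Y) (m) : Continuous (Y m) :=
  (hY.harmonic m).1.continuous

/-- The rotated functions lie in the same eigenspace and are again orthonormal, so they arise from
the Y_m by an orthogonal matrix, which preserves the sum of squares. -/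
theorem IsHarmonicONB.sum_sq_sphereMap (hY : IsHarmonicONB d ℓ Y)
    (O : EuclideanSpace ℝ (Fin (d + 1)) ≃ₗᵢ[ℝ] EuclideanSpace ℝ (Fin (d + 1)))
    (x : USphere (d + 1)) : ∑ m, Y m (sphereMap O x) ^ 2 = ∑ m, Y m x ^ 2 := by
  have hex : ∀ m, ∃ c : Fin (harmDim ℓ d) → ℝ, ∀ x, Y m (sphereMap O x) = ∑ k, c k * Y k x := by
    intro m
    obtain ⟨c, hc⟩ := (Submodule.mem_span_range_iff_exists_fun ℝ).1
      (hY.spans _ ((hY.harmonic m).comp_sphereMap O))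
    refine ⟨c, fun x => ?_⟩
    have := congrFun hc x
    simpa using this.symm
  choose A hA using hex
  set M : Matrix (Fin (harmDim ℓ d)) (Fin (harmDim ℓ d)) ℝ := Matrix.of A with hM
  have hint : ∀ k k', Integrable (fun x => Y k x * Y k' x) (unif (d + 1)) := fun k k' =>
    integrable_unif_of_continuous d.succ_pos ((hY.continuous k).mul (hY.continuous k'))
  have horth : M * M.transpose = 1 := by
    ext m m'
    have h1 := (measurePreserving_sphereMap d.succ_pos O).map_eq
    have h2 : ∫ x, Y m (sphereMap O x) * Y m' (sphereMap O x) ∂(unif (d + 1)) =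
        if m = m' then 1 else 0 := by
      rw [← hY.orthonormal m m']
      conv_rhs => rw [← h1]
      rw [integral_map (f := fun x => Y m x * Y m' x)
        (continuous_sphereMap O).measurable.aemeasurable
        ((hY.continuous m).mul (hY.continuous m')).aestronglyMeasurable]
    rw [Matrix.one_apply, ← h2]
    simp_rw [hA, Finset.sum_mul_sum]
    rw [integral_finsetSum]
    · simp only [Matrix.mul_apply, Matrix.transpose_apply, hM, Matrix.of_apply]
      refine Finset.sum_congr rfl fun k _ => ?_
      rw [integral_finsetSum]
      · simp_rw [show ∀ (k' : Fin (harmDim ℓ d)) x, A m k * Y k x * (A m' k' * Y k' x) =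
          (A m k * A m' k') * (Y k x * Y k' x) by intros; ring, integral_const_mul,
          hY.orthonormal]
        simp
      · intro k' _
        simp_rw [show ∀ x, A m k * Y k x * (A m' k' * Y k' x) =
          (A m k * A m' k') * (Y k x * Y k' x) by intros; ring]
        exact (hint k k').const_mul _
    · intro k _
      refine integrable_finsetSum _ fun k' _ => ?_
      simp_rw [show ∀ x, A m k * Y k x * (A m' k' * Y k' x) =
          (A m k * A m' k') * (Y k x * Y k' x) by intros; ring]
      exact (hint k k').const_mul _
  have horth' : M.transpose * M = 1 := mul_eq_one_comm.1 horth
  have hv : (fun m => Y m (sphereMap O x)) = M.mulVec fun k => Y k x := by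
    ext m
    rw [hA]
    rfl
  calc ∑ m, Y m (sphereMap O x) ^ 2
      = (fun m => Y m (sphereMap O x)) ⬝ᵥ (fun m => Y m (sphereMap O x)) := by
        simp [dotProduct, sq]
    _ = (fun m => Y m x) ⬝ᵥ (fun m => Y m x) := by
        rw [hv, Matrix.dotProduct_mulVec, Matrix.vecMul_mulVec, ← Matrix.dotProduct_mulVec,
          horth', Matrix.one_mulVec]
    _ = _ := by simp [dotProduct, sq]

/-- The addition theorem on the diagonal. -/
theorem IsHarmonicONB.sum_sq (hY : IsHarmonicONB d ℓ Y) (x : USphere (d + 1)) :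
    ∑ m, Y m x ^ 2 = harmDim ℓ d := by
  have := isProbabilityMeasure_unif d.succ_pos
  -- Isometries act transitively on the sphere; the constant is then found by integration.
  have hconst : ∀ z, ∑ m, Y m z ^ 2 = ∑ m, Y m x ^ 2 := by
    intro z
    obtain ⟨O, rfl⟩ := exists_sphereMap_eq x z
    exact hY.sum_sq_sphereMap O x
  have h1 : ∫ z, ∑ m, Y m z ^ 2 ∂(unif (d + 1)) = harmDim ℓ d := by
    rw [integral_finsetSum]
    · simp_rw [sq, hY.orthonormal]
      simp
    · exact fun m _ => integrable_unif_of_continuous d.succ_pos ((hY.continuous m).pow 2)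
  simp_rw [hconst] at h1
  simpa using h1

end Harmonic

/-! ### Averages of the correlation ρ and of its square -/

section NormalizedVector

variable {d ℓ : ℕ} {Y : Fin (harmDim ℓ d) → USphere (d + 1) → ℝ}

/-- The vector of the values at a point of the functions `Y m`, divided by the square root of their
number. -/
def normalizedVector {d n : ℕ} (Y : Fin n → USphere (d + 1) → ℝ) (x : USphere (d + 1)) :
    EuclideanSpace ℝ (Fin n) :=
  WithLp.toLp 2 fun m => Y m x / √n

theorem inner_normalizedVector {d n : ℕ} (Y : Fin n → USphere (d + 1) → ℝ)
    (x x' : USphere (d + 1)) :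
    inner ℝ (normalizedVector Y x) (normalizedVector Y x') = (∑ m, Y m x * Y m x') / n := by
  simp only [normalizedVector, PiLp.inner_apply, RCLike.inner_apply, conj_trivial,
    Finset.sum_div]
  refine Finset.sum_congr rfl fun m _ => ?_
  rw [div_mul_div_comm, Real.mul_self_sqrt (Nat.cast_nonneg n), mul_comm]

theorem sqrt_mul_inner_normalizedVector {d n : ℕ} (hn : 0 < n) (Y : Fin n → USphere (d + 1) → ℝ)
    (α : USphere n) (x : USphere (d + 1)) :
    √n * inner ℝ (normalizedVector Y x) (α : EuclideanSpace ℝ (Fin n)) = eigenfun Y α x := by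
  have hn' : (0 : ℝ) < √n := Real.sqrt_pos.2 (by exact_mod_cast hn)
  simp only [normalizedVector, PiLp.inner_apply, RCLike.inner_apply, conj_trivial,
    Finset.mul_sum, eigenfun]
  refine Finset.sum_congr rfl fun m _ => ?_
  field_simp

theorem IsHarmonicONB.measurable_normalizedVector (hY : IsHarmonicONB d ℓ Y) :
    Measurable (normalizedVector Y) := by
  have h : ∀ m, Continuous (Y m) := hY.continuous
  unfold normalizedVector
  exact Continuous.measurable (by fun_prop)

theorem IsHarmonicONB.norm_normalizedVector (hd : 2 ≤ d) (hY : IsHarmonicONB d ℓ Y)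
    (x : USphere (d + 1)) : ‖normalizedVector Y x‖ = 1 := by
  have hn : (harmDim ℓ d : ℝ) ≠ 0 := by exact_mod_cast (harmDim_pos ℓ hd).ne'
  have h : ‖normalizedVector Y x‖ ^ 2 = 1 := by
    rw [← real_inner_self_eq_norm_sq, inner_normalizedVector]
    simp_rw [← sq]
    rw [hY.sum_sq, div_self hn]
  nlinarith [norm_nonneg (normalizedVector Y x)]

/-- Bessel's inequality for the constant function 1. It treats all ℓ alike, including ℓ = 0, where
the mean does not vanish. -/
theorem IsHarmonicONB.sum_integral_sq_le (hY : IsHarmonicONB d ℓ Y) :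
    ∑ m, (∫ x, Y m x ∂(unif (d + 1))) ^ 2 ≤ 1 := by
  have := isProbabilityMeasure_unif d.succ_pos
  set σ := unif (d + 1)
  set c : Fin (harmDim ℓ d) → ℝ := fun m => ∫ x, Y m x ∂σ with hc
  have hi : ∀ {f : USphere (d + 1) → ℝ}, Continuous f → Integrable f σ := fun hf =>
    integrable_unif_of_continuous d.succ_pos hf
  have hYc : ∀ m, Continuous (Y m) := hY.continuous
  have h1 : ∫ x, ∑ m, c m * Y m x ∂σ = ∑ m, c m ^ 2 := by
    rw [integral_finsetSum _ fun m _ => hi (by fun_prop)]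
    simp_rw [integral_const_mul, sq]
    rfl
  have h2 : ∫ x, (∑ m, c m * Y m x) ^ 2 ∂σ = ∑ m, c m ^ 2 := by
    simp_rw [sq (∑ m, c m * Y m _), Finset.sum_mul_sum]
    rw [integral_finsetSum _ fun m _ => hi (by fun_prop)]
    refine Finset.sum_congr rfl fun m _ => ?_
    rw [integral_finsetSum _ fun m' _ => hi (by fun_prop)]
    simp_rw [show ∀ m' x, c m * Y m x * (c m' * Y m' x) = (c m * c m') * (Y m x * Y m' x) by
      intros; ring, integral_const_mul]
    simp [σ, hY.orthonormal, sq]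
  have h3 : 0 ≤ ∫ x, (1 - ∑ m, c m * Y m x) ^ 2 ∂σ := integral_nonneg fun _ => sq_nonneg _
  simp_rw [show ∀ a : ℝ, (1 - a) ^ 2 = 1 - 2 * a + a ^ 2 by intros; ring] at h3
  rw [integral_add (hi (by fun_prop)) (hi (by fun_prop)),
    integral_sub (hi (by fun_prop)) (hi (by fun_prop)), integral_const_mul, h1, h2] at h3
  simp at h3
  linarith

theorem IsHarmonicONB.integral_inner_le (hY : IsHarmonicONB d ℓ Y) :
    ∫ p : USphere (d + 1) × USphere (d + 1), inner ℝ (normalizedVector Y p.1)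
      (normalizedVector Y p.2) ∂((unif (d + 1)).prod (unif (d + 1))) ≤ 1 / harmDim ℓ d := by
  have := isProbabilityMeasure_unif d.succ_pos
  have hi : ∀ m, Integrable (Y m) (unif (d + 1)) := fun m =>
    integrable_unif_of_continuous d.succ_pos (hY.continuous m)
  simp_rw [inner_normalizedVector]
  rw [integral_div, integral_finsetSum _ fun m _ => (hi m).mul_prod (hi m)]
  simp_rw [integral_prod_mul, ← sq]
  gcongr
  exact hY.sum_integral_sq_le

/-- Expanding the square leaves n⁻² times the sum over m, m' of the squared Gram entries, of which
exactly n equal 1. -/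
theorem IsHarmonicONB.integral_inner_sq_le (hd : 2 ≤ d) (hY : IsHarmonicONB d ℓ Y) :
    ∫ p : USphere (d + 1) × USphere (d + 1), inner ℝ (normalizedVector Y p.1)
      (normalizedVector Y p.2) ^ 2 ∂((unif (d + 1)).prod (unif (d + 1))) ≤ 1 / harmDim ℓ d := by
  have := isProbabilityMeasure_unif d.succ_pos
  have hn : (harmDim ℓ d : ℝ) ≠ 0 := by exact_mod_cast (harmDim_pos ℓ hd).ne'
  have hi : ∀ m m', Integrable (fun x => Y m x * Y m' x) (unif (d + 1)) := fun m m' =>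
    integrable_unif_of_continuous d.succ_pos ((hY.continuous m).mul (hY.continuous m'))
  have e : ∀ p : USphere (d + 1) × USphere (d + 1),
      (inner ℝ (normalizedVector Y p.1) (normalizedVector Y p.2) : ℝ) ^ 2 =
        (∑ m, ∑ m', (Y m p.1 * Y m' p.1) * (Y m p.2 * Y m' p.2)) / (harmDim ℓ d : ℝ) ^ 2 := by
    intro p
    rw [inner_normalizedVector, div_pow, sq (∑ m, _), Finset.sum_mul_sum]
    congr 1
    exact Finset.sum_congr rfl fun m _ => Finset.sum_congr rfl fun m' _ => by ring
  simp_rw [e]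
  rw [integral_div, integral_finsetSum _ fun m _ =>
    integrable_finsetSum _ fun m' _ => (hi m m').mul_prod (hi m m')]
  have h : ∀ m, ∫ p : USphere (d + 1) × USphere (d + 1),
      ∑ m', (Y m p.1 * Y m' p.1) * (Y m p.2 * Y m' p.2)
        ∂((unif (d + 1)).prod (unif (d + 1))) = 1 := by
    intro m
    rw [integral_finsetSum _ fun m' _ => (hi m m').mul_prod (hi m m')]
    have h' : ∀ m', ∫ p : USphere (d + 1) × USphere (d + 1),
        (Y m p.1 * Y m' p.1) * (Y m p.2 * Y m' p.2) ∂((unif (d + 1)).prod (unif (d + 1))) =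
          (if m = m' then 1 else 0) * (if m = m' then 1 else 0) := fun m' => by
      rw [integral_prod_mul (fun x => Y m x * Y m' x) (fun x => Y m x * Y m' x), hY.orthonormal]
    simp_rw [h']
    simp
  simp_rw [h]
  simp only [Finset.sum_const, Finset.card_univ, Fintype.card_fin, nsmul_eq_mul, mul_one]
  rw [sq, div_mul_cancel_left₀ hn, one_div]

end NormalizedVector

end SphHarm

end

/-! ### Borel-Cantelli -/

theorem proposition2 (d : ℕ) (hd : 2 ≤ d)
    (Y : ∀ ℓ : ℕ, Fin (SphHarm.harmDim ℓ d) → SphHarm.USphere (d + 1) → ℝ)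
    (hY : ∀ ℓ, SphHarm.IsHarmonicONB d ℓ (Y ℓ))
    (ε : ℕ → ℝ) (hε : ∀ ℓ, 0 < ε ℓ)
    (hsum : Summable fun ℓ => 1 / ((SphHarm.harmDim ℓ d : ℝ) * ε ℓ ^ 3)) :
    SphHarm.coeffMeasure d
      {α | ∃ᶠ ℓ in atTop, ε ℓ < SphHarm.dKolGauss (SphHarm.eigenfun (Y ℓ) (α ℓ))} = 0 := by
  obtain ⟨C, hC, H⟩ := SphHarm.exists_kolDist_concentration
  have hσ := SphHarm.isProbabilityMeasure_unif d.succ_pos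
  have hμ : ∀ ℓ, IsProbabilityMeasure (SphHarm.unif (SphHarm.harmDim ℓ d)) := fun ℓ =>
    SphHarm.isProbabilityMeasure_unif (SphHarm.harmDim_pos ℓ hd)
  refine measure_setOfPred_frequently_eq_zero (ne_top_of_le_ne_top ?_ (ENNReal.tsum_le_tsum fun ℓ =>
    (?_ : _ ≤ ENNReal.ofReal (C * (1 / ((SphHarm.harmDim ℓ d : ℝ) * ε ℓ ^ 3))))))
  · rw [← ENNReal.ofReal_tsum_of_nonneg _ (hsum.mul_left C)]
    · exact ENNReal.ofReal_ne_top
    · intro ℓ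
      have := hε ℓ
      positivity
  -- Only the marginals of the product measure enter, and an inequality for the preimage is enough,
  -- so the event need not be shown measurable.
  · refine ((measurePreserving_eval_infinitePi (fun ℓ =>
      SphHarm.unif (SphHarm.harmDim ℓ d)) ℓ).measure_preimage_le
        {α | ε ℓ < SphHarm.dKolGauss (SphHarm.eigenfun (Y ℓ) α)}).trans ?_
    have hn := SphHarm.harmDim_pos ℓ hd
    have := H _ _ (SphHarm.unif (d + 1)) (SphHarm.normalizedVector (Y ℓ)) (ε ℓ) hn (hε ℓ)
      (hY ℓ).measurable_normalizedVector ((hY ℓ).norm_normalizedVector hd)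
      (hY ℓ).integral_inner_le ((hY ℓ).integral_inner_sq_le hd)
    simp_rw [SphHarm.sqrt_mul_inner_normalizedVector hn] at this
    exact this
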